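/- Let $\Bbbk$ be an algebraically closed field. A \emph{tensor category} is an additive $\Bbbk$-linear monoidal category whose tensor product is $\Bbbk$-bilinear on morphisms; a \emph{tensor functor} is a $\Bbbk$-linear (strong) monoidal functor. A \emph{fusion category} is a tensor category which is semisimple (abelian, every object being a finite direct sum of simple objects), with finite-dimensional morphism spaces, finitely many isomorphism classes of simple objects, and simple unit object. Let $\eta\in\Bbbk$ be a root of unity of order $>2$ such that $\kappa:=\eta+\eta^{-1}\neq 0$. Let $d$ be the order of $\eta$ if this order is odd and half the order of $\eta$ if it is even (so $d\ge 3$), and put $[n]=\frac{\eta^n-\eta^{-n}}{\eta-\eta^{-1}}$; then $[n]\neq 0$ for $0<n<d$. Let $\mathcal{TL}_\kappa$ be the Temperley--Lieb category, that is, the idempotent completion of the tensor category freely generated by a self-dual object of dimension $\kappa$: an object $T$ with morphisms $n:I\to T\otimes T$ and $u:T\otimes T\to I$ satisfying the two zigzag identities and $u\circ n=\kappa\,1_I$. Let $e_i$ be the endomorphism $n\circ u$ on the $i$-th and $(i+1)$-st factors of a tensor power of $T$. The Jones--Wenzl projectors $p_m\in\operatorname{End}(T^{\otimes m})$, $0\le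 m\le d-1$, are the idempotents given by $p_0=1$, $p_1=1$ and $$p_{m+1}=p_m\otimes 1-\frac{[m]}{[m+1]}\,(p_m\otimes 1)\circ e_m\circ(p_m\otimes 1)\qquad(1\le m\le d-2),$$ and $T_m$ denotes the image of $p_m$ (so $T_0=I$, $T_1=T$). Let $\mathcal T_\kappa=\mathcal{TL}_\kappa/\langle p_{d-1}\rangle$ be the quotient by the ideal of morphisms tensor generated by $p_{d-1}$, that is, the smallest class of morphisms that contains $p_{d-1}$ and all zero morphisms and is closed under sums, under composition with arbitrary morphisms on either side, and under tensor product with arbitrary objects on either side. Let $\pi:\mathcal{TL}_\kappa\to\mathcal T_\kappa$ be the projection. Let $\mathcal D$ be a rigid fusion category over $\Bbbk$ whose simple objects are, up to isomorphism and without repetition, $S_0,\dots,S_{d-2}$, with $$S_1\otimes S_i\simeq S_{i-1}\oplus S_{i+1}\quad(0<i<d-2),\qquad S_1\otimes S_{d-2}\simeq S_{d-3}.$$ Then every tensor functor $F:\mathcal{TL}_\kappa\to\mathcal D$ with $F(T_i)\simeq S_i$ for $i=0,\dots,d-2$ factors through $\mathcal T_\kappa$: there are a tensor functor $G:\mathcal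 T_\kappa\to\mathcal D$ and a monoidal natural isomorphism $G\circ\pi\cong F$. -/

import Mathlib

open CategoryTheory CategoryTheory.MonoidalCategory CategoryTheory.Limits

universe u

/-! ## Quantum numbers -/

/-- The quantum number `[n]_η = (η ^ n - η ^ (-n)) / (η - η⁻¹)`. -/
def quantumNumber {k : Type*} [Field k] (η : k) (n : ℕ) : k :=
  (η ^ n - (η⁻¹) ^ n) / (η - η⁻¹)

/-- For a root of unity `η`: the order of `η` if it is odd, half the order of `η` if it is even. -/
noncomputable def quantumOrder {k : Type*} [Field k] (η : k) : ℕ :=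
  if Odd (orderOf η) then orderOf η else orderOf η / 2

theorem quantumNumber_ne_zero {k : Type*} [Field k] {η : k} (hη : 2 < orderOf η) {n : ℕ}
    (hn : n < quantumOrder η) (m : ℕ) (hm : 0 < m) (hmn : m ≤ n) : quantumNumber η m ≠ 0 := by
  have h0 : η ≠ 0 := by
    rintro rfl
    simp at hη
  have key : ∀ j : ℕ, 0 < j → η ^ j = (η⁻¹) ^ j → orderOf η ∣ 2 * j := by
    intro j _ hj
    apply orderOf_dvd_of_pow_eq_one
    rw [two_mul, pow_add]
    nth_rewrite 2 [hj]
    rw [← mul_pow, mul_inv_cancel₀ h0, one_pow]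
  have aux : ∀ j : ℕ, 0 < j → j < quantumOrder η → η ^ j ≠ (η⁻¹) ^ j := by
    intro j hj hjd h
    have hd := key j hj h
    unfold quantumOrder at hjd
    split_ifs at hjd with hodd
    · have := Nat.le_of_dvd hj
        ((Nat.Coprime.dvd_mul_left (Nat.coprime_two_right.mpr hodd)).mp hd)
      omega
    · have := Nat.le_of_dvd (by omega) hd
      omega
  have h1 : η - η⁻¹ ≠ 0 := by
    intro h
    have := key 1 one_pos (by simpa using sub_eq_zero.mp h)
    have := Nat.le_of_dvd (by omega) this
    omega
  exact div_ne_zero (sub_ne_zero.mpr (aux m hm (by omega))) h1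

theorem quantumNumber_one {k : Type*} [Field k] {η : k} (h : quantumNumber η 1 ≠ 0) :
    quantumNumber η 1 = 1 := by
  unfold quantumNumber at *
  rw [pow_one, pow_one] at *
  exact div_self (fun h' => h (by rw [h', zero_div]))

theorem quantumNumber_rec {k : Type*} [Field k] {η : k} (h0 : η ≠ 0) (n : ℕ) :
    (η + η⁻¹) * quantumNumber η (n + 1) = quantumNumber η n + quantumNumber η (n + 2) := by
  unfold quantumNumber
  rw [← mul_div_assoc, ← add_div]
  congr 1
  rw [pow_succ, pow_succ _ (n + 1), pow_succ, pow_succ _ (n + 1), pow_succ _ n]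
  linear_combination (η ^ n - η⁻¹ ^ n) * mul_inv_cancel₀ h0

/-! ## Monoidal structure on the idempotent completion -/

namespace CategoryTheory.Idempotents.Karoubi

section Linear

variable {C : Type*} [Category* C] [Preadditive C]
variable {R : Type*} [Semiring R] [Linear R C]

instance : Linear R (Karoubi C) where
  homModule P Q :=
    { smul := fun r f => ⟨r • f.f, by simp⟩
      one_smul := fun f => by ext; exact one_smul R f.f
      mul_smul := fun r s f => by ext; exact mul_smul r s f.f
      smul_zero := fun r => by ext; exact smul_zero r
      smul_add := fun r f g => by ext; exact smul_add r f.f g.f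
      add_smul := fun r s f => by ext; exact add_smul r s f.f
      zero_smul := fun f => by ext; exact zero_smul R f.f }
  smul_comp := fun P Q S r f g => by ext; exact Linear.smul_comp P.X Q.X S.X r f.f g.f
  comp_smul := fun P Q S f r g => by ext; exact Linear.comp_smul P.X Q.X S.X f.f r g.f

@[simp] theorem smul_f {P Q : Karoubi C} (r : R) (f : P ⟶ Q) : (r • f).f = r • f.f := rfl

end Linear

section Monoidal

variable {C : Type*} [Category* C] [MonoidalCategory C]

/-- The associator of the idempotent completion. -/
def associatorIso (P Q R : Karoubi C) :
    (⟨(P.X ⊗ Q.X) ⊗ R.X, (P.p ⊗ₘ Q.p) ⊗ₘ R.p, by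
      simp only [tensorHom_comp_tensorHom, idem]⟩ : Karoubi C) ≅
      ⟨P.X ⊗ (Q.X ⊗ R.X), P.p ⊗ₘ (Q.p ⊗ₘ R.p), by
        simp only [tensorHom_comp_tensorHom, idem]⟩ where
  hom := ⟨((P.p ⊗ₘ Q.p) ⊗ₘ R.p) ≫ (α_ P.X Q.X R.X).hom, by
    simp only [Category.assoc, ← associator_naturality, tensorHom_comp_tensorHom_assoc,
      tensorHom_comp_tensorHom, idem]⟩
  inv := ⟨(α_ P.X Q.X R.X).inv ≫ ((P.p ⊗ₘ Q.p) ⊗ₘ R.p), by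
    simp only [Category.assoc, associator_inv_naturality_assoc, tensorHom_comp_tensorHom, idem]⟩
  hom_inv_id := by
    ext
    simp only [comp_f, id_f, Category.assoc, Iso.hom_inv_id_assoc, tensorHom_comp_tensorHom, idem]
  inv_hom_id := by
    ext
    simp only [comp_f, id_f, Category.assoc, associator_naturality, Iso.inv_hom_id_assoc,
      tensorHom_comp_tensorHom, associator_naturality_assoc, idem]

/-- The left unitor of the idempotent completion. -/
def leftUnitorIso (P : Karoubi C) :
    (⟨𝟙_ C ⊗ P.X, 𝟙 (𝟙_ C) ⊗ₘ P.p, by simp⟩ : Karoubi C) ≅ P where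
  hom := ⟨(λ_ P.X).hom ≫ P.p, by simp⟩
  inv := ⟨P.p ≫ (λ_ P.X).inv, by simp⟩
  hom_inv_id := by ext; simp
  inv_hom_id := by ext; simp

/-- The right unitor of the idempotent completion. -/
def rightUnitorIso (P : Karoubi C) :
    (⟨P.X ⊗ 𝟙_ C, P.p ⊗ₘ 𝟙 (𝟙_ C), by simp⟩ : Karoubi C) ≅ P where
  hom := ⟨(ρ_ P.X).hom ≫ P.p, by simp⟩
  inv := ⟨P.p ≫ (ρ_ P.X).inv, by simp⟩
  hom_inv_id := by ext; simp
  inv_hom_id := by ext; simp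

instance : MonoidalCategoryStruct (Karoubi C) where
  tensorObj P Q := ⟨P.X ⊗ Q.X, P.p ⊗ₘ Q.p, by simp⟩
  tensorHom f g := ⟨f.f ⊗ₘ g.f, by simp⟩
  whiskerLeft P _ _ g := ⟨P.p ⊗ₘ g.f, by simp⟩
  whiskerRight f Q := ⟨f.f ⊗ₘ Q.p, by simp⟩
  tensorUnit := ⟨𝟙_ C, 𝟙 _, by simp⟩
  associator P Q R := associatorIso P Q R
  leftUnitor P := leftUnitorIso P
  rightUnitor P := rightUnitorIso P

@[simp] theorem tensorObj_X (P Q : Karoubi C) : (P ⊗ Q).X = P.X ⊗ Q.X := rfl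
@[simp] theorem tensorObj_p (P Q : Karoubi C) : (P ⊗ Q).p = P.p ⊗ₘ Q.p := rfl
@[simp] theorem tensorUnit_X : (𝟙_ (Karoubi C)).X = 𝟙_ C := rfl
@[simp] theorem tensorUnit_p : (𝟙_ (Karoubi C)).p = 𝟙 (𝟙_ C) := rfl
@[simp] theorem tensorHom_f {P Q R S : Karoubi C} (f : P ⟶ Q) (g : R ⟶ S) :
    (f ⊗ₘ g).f = f.f ⊗ₘ g.f := rfl
@[simp] theorem whiskerLeft_f (P : Karoubi C) {Q R : Karoubi C} (g : Q ⟶ R) :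
    (P ◁ g).f = P.p ⊗ₘ g.f := rfl
@[simp] theorem whiskerRight_f {P Q : Karoubi C} (f : P ⟶ Q) (R : Karoubi C) :
    (f ▷ R).f = f.f ⊗ₘ R.p := rfl
@[simp] theorem associator_hom_f (P Q R : Karoubi C) :
    (α_ P Q R).hom.f = ((P.p ⊗ₘ Q.p) ⊗ₘ R.p) ≫ (α_ P.X Q.X R.X).hom := rfl
@[simp] theorem associator_inv_f (P Q R : Karoubi C) :
    (α_ P Q R).inv.f = (α_ P.X Q.X R.X).inv ≫ ((P.p ⊗ₘ Q.p) ⊗ₘ R.p) := rfl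
@[simp] theorem leftUnitor_hom_f (P : Karoubi C) :
    (λ_ P).hom.f = (λ_ P.X).hom ≫ P.p := rfl
@[simp] theorem leftUnitor_inv_f (P : Karoubi C) :
    (λ_ P).inv.f = P.p ≫ (λ_ P.X).inv := rfl
@[simp] theorem rightUnitor_hom_f (P : Karoubi C) :
    (ρ_ P).hom.f = (ρ_ P.X).hom ≫ P.p := rfl
@[simp] theorem rightUnitor_inv_f (P : Karoubi C) :
    (ρ_ P).inv.f = P.p ≫ (ρ_ P.X).inv := rfl

/-- The idempotent completion of a monoidal category, with tensor product
`(X, p) ⊗ (Y, q) = (X ⊗ Y, p ⊗ q)`. -/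
instance : MonoidalCategory (Karoubi C) := MonoidalCategory.ofTensorHom
  (id_tensorHom_id := by intros; ext; simp)
  (id_tensorHom := by intros; ext; simp)
  (tensorHom_id := by intros; ext; simp)
  (tensorHom_comp_tensorHom := by intros; ext; simp)
  (associator_naturality := by
    intros; ext
    simp only [comp_f, tensorHom_f, associator_hom_f, Category.assoc,
      tensorHom_comp_tensorHom, associator_naturality, associator_naturality_assoc,
      p_comp, comp_p])
  (leftUnitor_naturality := by
    intros; ext; simp)
  (rightUnitor_naturality := by
    intros; ext; simp)
  (pentagon := by
    intro P Q R S; ext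
    have h₁ : ((((P.p ⊗ₘ Q.p) ⊗ₘ R.p) ≫ (α_ P.X Q.X R.X).hom) ⊗ₘ S.p) =
        (((P.p ⊗ₘ Q.p) ⊗ₘ R.p) ⊗ₘ S.p) ≫ (α_ P.X Q.X R.X).hom ▷ S.X := by
      rw [← tensorHom_id, tensorHom_comp_tensorHom, Category.comp_id]
    have h₂ : (P.p ⊗ₘ (((Q.p ⊗ₘ R.p) ⊗ₘ S.p) ≫ (α_ Q.X R.X S.X).hom)) =
        (P.p ⊗ₘ ((Q.p ⊗ₘ R.p) ⊗ₘ S.p)) ≫ P.X ◁ (α_ Q.X R.X S.X).hom := by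
      rw [← id_tensorHom, tensorHom_comp_tensorHom, Category.comp_id]
    have h₃ : (α_ P.X Q.X R.X).hom ▷ S.X ≫ ((P.p ⊗ₘ (Q.p ⊗ₘ R.p)) ⊗ₘ S.p) =
        (((P.p ⊗ₘ Q.p) ⊗ₘ R.p) ⊗ₘ S.p) ≫ (α_ P.X Q.X R.X).hom ▷ S.X := by
      simp only [← tensorHom_id, tensorHom_comp_tensorHom, Category.comp_id, Category.id_comp,
        associator_naturality]
    simp only [comp_f, tensorHom_f, associator_hom_f, id_f, tensorObj_X, tensorObj_p, h₁, h₂,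
      Category.assoc]
    simp only [← associator_naturality_assoc, tensorHom_comp_tensorHom_assoc,
      tensorHom_comp_tensorHom, idem,
      reassoc_of% h₃, pentagon])
  (triangle := by
    intro P Q; ext
    simp only [comp_f, tensorHom_f, associator_hom_f, id_f, tensorObj_X, leftUnitor_hom_f,
      rightUnitor_hom_f, tensorUnit_X, tensorUnit_p, Category.assoc]
    have h₁ : (P.p ⊗ₘ ((λ_ Q.X).hom ≫ Q.p)) = P.X ◁ (λ_ Q.X).hom ≫ (P.p ⊗ₘ Q.p) := by
      rw [← id_tensorHom, tensorHom_comp_tensorHom, Category.id_comp]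
    have h₂ : (((ρ_ P.X).hom ≫ P.p) ⊗ₘ Q.p) = (ρ_ P.X).hom ▷ Q.X ≫ (P.p ⊗ₘ Q.p) := by
      rw [← tensorHom_id, tensorHom_comp_tensorHom, Category.id_comp]
    have h₃ : ((P.p ⊗ₘ 𝟙 (𝟙_ C)) ⊗ₘ Q.p) ≫ (ρ_ P.X).hom ▷ Q.X =
        (ρ_ P.X).hom ▷ Q.X ≫ (P.p ⊗ₘ Q.p) := by
      rw [← tensorHom_id, tensorHom_comp_tensorHom, tensorHom_comp_tensorHom, tensorHom_id,
        rightUnitor_naturality, Category.comp_id, Category.id_comp]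
    rw [h₁, h₂, triangle_assoc, reassoc_of% h₃, tensorHom_comp_tensorHom, idem, idem])

variable [Preadditive C] [MonoidalPreadditive C]

instance : MonoidalPreadditive (Karoubi C) where
  whiskerLeft_zero := by intros; ext; simp
  zero_whiskerRight := by intros; ext; simp
  whiskerLeft_add := by intros; ext; simp [MonoidalPreadditive.tensor_add]
  add_whiskerRight := by intros; ext; simp [MonoidalPreadditive.add_tensor]

variable {R : Type*} [Semiring R] [Linear R C]

instance [MonoidalLinear R C] : MonoidalLinear R (Karoubi C) where
  whiskerLeft_smul := by intros; ext; simp [MonoidalCategory.tensorHom_def]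
  smul_whiskerRight := by intros; ext; simp [MonoidalCategory.tensorHom_def]

end Monoidal

end CategoryTheory.Idempotents.Karoubi

/-! ## Self-dual objects and Jones-Wenzl projectors -/

/-- A self-dual object of a monoidal category: an object `T` equipped with morphisms
`n : I ⟶ T ⊗ T` and `u : T ⊗ T ⟶ I` satisfying the two zigzag identities. -/
structure SelfDualObject (C : Type*) [Category* C] [MonoidalCategory C] where
  T : C
  n : 𝟙_ C ⟶ T ⊗ T
  u : T ⊗ T ⟶ 𝟙_ C
  zigzag_left : (λ_ T).inv ≫ n ▷ T ≫ (α_ T T T).hom ≫ T ◁ u ≫ (ρ_ T).hom = 𝟙 T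
  zigzag_right : (ρ_ T).inv ≫ T ◁ n ≫ (α_ T T T).inv ≫ u ▷ T ≫ (λ_ T).hom = 𝟙 T

namespace SelfDualObject

section Power

variable {C : Type*} [Category* C] [MonoidalCategory C] (A : SelfDualObject C)

/-- The tensor powers `T ^ ⊗ n`, bracketed to the left: `I`, `T`, `T ⊗ T`, `(T ⊗ T) ⊗ T`, … -/
def pow : ℕ → C
  | 0 => 𝟙_ C
  | 1 => A.T
  | n + 2 => pow (n + 1) ⊗ A.T

/-- `e i` is the Temperley-Lieb generator `e_{i+1}` of the endomorphism algebra of the tensor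
power `T ^ ⊗ (i + 2)`, that is, `n ∘ u` acting on the last two tensor factors. -/
def e : (i : ℕ) → (A.pow (i + 2) ⟶ A.pow (i + 2))
  | 0 => A.u ≫ A.n
  | i + 1 => (α_ (A.pow (i + 1)) A.T A.T).hom ≫ A.pow (i + 1) ◁ (A.u ≫ A.n) ≫
      (α_ (A.pow (i + 1)) A.T A.T).inv

end Power

section Linear

variable {k : Type*} [Field k] {C : Type*} [Category* C] [Preadditive C] [Linear k C]
  [MonoidalCategory C] (A : SelfDualObject C)

variable (k) in
/-- The self-dual object has dimension `κ`: `u ∘ n = κ 1_I`. -/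
def HasDimension (κ : k) : Prop := A.n ≫ A.u = κ • 𝟙 (𝟙_ C)

/-- The Jones-Wenzl projectors
`p_{n+1} = p_n ⊗ 1 - [n] / [n+1] (p_n ⊗ 1) ∘ e_n ∘ (p_n ⊗ 1)` for `n ≥ 1`, with `p_1 = 1`
(and `p_0 = 1`). They are meaningful as long as the quantum numbers `[1], …, [n]` do not
vanish. -/
def jonesWenzl (η : k) : (n : ℕ) → (A.pow n ⟶ A.pow n)
  | 0 => 𝟙 _
  | 1 => 𝟙 _
  | n + 2 => jonesWenzl η (n + 1) ▷ A.T -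
      (quantumNumber η (n + 1) / quantumNumber η (n + 2)) •
        (jonesWenzl η (n + 1) ▷ A.T ≫ A.e n ≫ jonesWenzl η (n + 1) ▷ A.T)

end Linear

section Relations

variable {C : Type*} [Category* C] [MonoidalCategory C] (A : SelfDualObject C)

/-- `(1 ⊗ e) (e ⊗ 1) (1 ⊗ e) = 1 ⊗ e` on `T ⊗ (T ⊗ T)`. -/
theorem tl_base :
    (A.T ◁ (A.u ≫ A.n)) ≫ (α_ A.T A.T A.T).inv ≫ (A.u ≫ A.n) ▷ A.T ≫ (α_ A.T A.T A.T).hom ≫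
      (A.T ◁ (A.u ≫ A.n)) = A.T ◁ (A.u ≫ A.n) := by
  have h₁ : A.T ◁ A.n ≫ (α_ A.T A.T A.T).inv ≫ A.u ▷ A.T = (ρ_ A.T).hom ≫ (λ_ A.T).inv := by
    rw [← cancel_epi (ρ_ A.T).inv, ← cancel_mono (λ_ A.T).hom]
    simpa using A.zigzag_right
  have h₂ : A.n ▷ A.T ≫ (α_ A.T A.T A.T).hom ≫ A.T ◁ A.u = (λ_ A.T).hom ≫ (ρ_ A.T).inv := by
    rw [← cancel_epi (λ_ A.T).inv, ← cancel_mono (ρ_ A.T).hom]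
    simpa using A.zigzag_left
  simp only [whiskerLeft_comp, comp_whiskerRight, Category.assoc]
  rw [reassoc_of% h₁, reassoc_of% h₂]
  simp

theorem comm_e_aux {P T : C} (f : P ⟶ P) (g : T ⊗ T ⟶ T ⊗ T) :
    f ▷ T ▷ T ≫ (α_ P T T).hom ≫ P ◁ g ≫ (α_ P T T).inv =
      ((α_ P T T).hom ≫ P ◁ g ≫ (α_ P T T).inv) ≫ f ▷ T ▷ T := by
  rw [associator_naturality_left_assoc, ← whisker_exchange_assoc]
  simp

theorem comm_e (i : ℕ) (f : A.pow (i + 1) ⟶ A.pow (i + 1)) :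
    (f ▷ A.T ▷ A.T : A.pow (i + 3) ⟶ A.pow (i + 3)) ≫ A.e (i + 1) =
      A.e (i + 1) ≫ (f ▷ A.T ▷ A.T : A.pow (i + 3) ⟶ A.pow (i + 3)) :=
  comm_e_aux f (A.u ≫ A.n)

theorem tl_rel_aux {P T : C} (g : T ⊗ T ⟶ T ⊗ T)
    (h : T ◁ g ≫ (α_ T T T).inv ≫ g ▷ T ≫ (α_ T T T).hom ≫ T ◁ g = T ◁ g) :
    ((α_ (P ⊗ T) T T).hom ≫ (P ⊗ T) ◁ g ≫ (α_ (P ⊗ T) T T).inv) ≫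
      ((α_ P T T).hom ≫ P ◁ g ≫ (α_ P T T).inv) ▷ T ≫
      (α_ (P ⊗ T) T T).hom ≫ (P ⊗ T) ◁ g ≫ (α_ (P ⊗ T) T T).inv =
    (α_ (P ⊗ T) T T).hom ≫ (P ⊗ T) ◁ g ≫ (α_ (P ⊗ T) T T).inv := by
  have h₁ : ((α_ (P ⊗ T) T T).hom ≫ (P ⊗ T) ◁ g ≫ (α_ (P ⊗ T) T T).inv) ≫
      ((α_ P T T).hom ≫ P ◁ g ≫ (α_ P T T).inv) ▷ T ≫
      (α_ (P ⊗ T) T T).hom ≫ (P ⊗ T) ◁ g ≫ (α_ (P ⊗ T) T T).inv =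
      (α_ (P ⊗ T) T T).hom ≫ (α_ P T (T ⊗ T)).hom ≫
        P ◁ (T ◁ g ≫ (α_ T T T).inv ≫ g ▷ T ≫ (α_ T T T).hom ≫ T ◁ g) ≫
        (α_ P T (T ⊗ T)).inv ≫ (α_ (P ⊗ T) T T).inv := by
    monoidal
  rw [h₁, h]
  monoidal

theorem tl_rel (i : ℕ) :
    A.e (i + 1) ≫ (A.e i ▷ A.T : A.pow (i + 3) ⟶ A.pow (i + 3)) ≫ A.e (i + 1) = A.e (i + 1) := by
  cases i with
  | zero =>
    have := A.tl_base
    change ((α_ A.T A.T A.T).hom ≫ A.T ◁ (A.u ≫ A.n) ≫ (α_ A.T A.T A.T).inv) ≫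
      (A.u ≫ A.n) ▷ A.T ≫ (α_ A.T A.T A.T).hom ≫ A.T ◁ (A.u ≫ A.n) ≫ (α_ A.T A.T A.T).inv =
      (α_ A.T A.T A.T).hom ≫ A.T ◁ (A.u ≫ A.n) ≫ (α_ A.T A.T A.T).inv
    simp only [Category.assoc]
    rw [reassoc_of% this]
  | succ i => exact tl_rel_aux (P := A.pow (i + 1)) (A.u ≫ A.n) A.tl_base

end Relations

section Idempotent

variable {k : Type*} [Field k] {C : Type*} [Category* C] [Preadditive C] [Linear k C]

theorem step_aux {X : C} {q e : X ⟶ X} {c t : k} (hct : c * t = 1) (hq : q ≫ q = q)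
    (h : q ≫ e ≫ q ≫ e ≫ q = t • (q ≫ e ≫ q)) :
    (q - c • (q ≫ e ≫ q)) ≫ (q - c • (q ≫ e ≫ q)) = q - c • (q ≫ e ≫ q) := by
  simp only [Preadditive.sub_comp, Preadditive.comp_sub, Linear.smul_comp, Linear.comp_smul,
    Category.assoc, reassoc_of% hq, hq, h, smul_smul, hct]
  module

theorem trace_aux {X : C} {Q E e : X ⟶ X} {c κ t : k} (ht : κ - c = t) (hQ : Q ≫ Q = Q)
    (hQe : Q ≫ e = e ≫ Q) (he : e ≫ e = κ • e) (hE : e ≫ E ≫ e = e) :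
    e ≫ (Q - c • (Q ≫ E ≫ Q)) ≫ e = t • (Q ≫ e) := by
  have h : e ≫ Q ≫ E ≫ Q ≫ e = Q ≫ e := by
    rw [hQe, ← reassoc_of% hQe, reassoc_of% hE, ← hQe, reassoc_of% hQ]
  simp only [Preadditive.sub_comp, Preadditive.comp_sub, Linear.smul_comp, Linear.comp_smul,
    Category.assoc, h]
  rw [← reassoc_of% hQe, he, ← ht, Linear.comp_smul, sub_smul]

variable [MonoidalCategory C] {A : SelfDualObject C}

theorem u_n_u {κ : k} (hA : A.HasDimension k κ) :
    (A.u ≫ A.n) ≫ (A.u ≫ A.n) = κ • (A.u ≫ A.n) := by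
  have h : A.n ≫ A.u = κ • 𝟙 (𝟙_ C) := hA
  rw [Category.assoc, reassoc_of% h]
  simp

variable [MonoidalPreadditive C] [MonoidalLinear k C]

theorem sub_whiskerRight {X Y : C} (f g : X ⟶ Y) (Z : C) :
    (f - g) ▷ Z = f ▷ Z - g ▷ Z :=
  (tensorRight Z).map_sub

theorem e_e_aux {κ : k} {P T : C} {g : T ⊗ T ⟶ T ⊗ T} (hg : g ≫ g = κ • g) :
    ((α_ P T T).hom ≫ P ◁ g ≫ (α_ P T T).inv) ≫ ((α_ P T T).hom ≫ P ◁ g ≫ (α_ P T T).inv) =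
      κ • ((α_ P T T).hom ≫ P ◁ g ≫ (α_ P T T).inv) := by
  simp only [Category.assoc, Iso.inv_hom_id_assoc]
  rw [← whiskerLeft_comp_assoc, hg]
  simp

theorem e_e {κ : k} (hA : A.HasDimension k κ) (i : ℕ) : A.e i ≫ A.e i = κ • A.e i := by
  cases i with
  | zero => exact u_n_u hA
  | succ i => exact e_e_aux (u_n_u hA)

variable (A) in
/-- `p_n ⊗ 1 ⊗ 1` on `T ^ ⊗ (n + 2)`. -/
def jonesWenzlRight (η : k) : (n : ℕ) → (A.pow (n + 2) ⟶ A.pow (n + 2))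
  | 0 => 𝟙 _
  | n + 1 => A.jonesWenzl η (n + 1) ▷ A.T ▷ A.T

theorem jonesWenzl_aux {η : k} (hA : A.HasDimension k (η + η⁻¹)) (n : ℕ)
    (hn : ∀ m, 0 < m → m ≤ n + 1 → quantumNumber η m ≠ 0) :
    A.jonesWenzl η (n + 1) ≫ A.jonesWenzl η (n + 1) = A.jonesWenzl η (n + 1) ∧
    A.e n ≫ (A.jonesWenzl η (n + 1) ▷ A.T : A.pow (n + 2) ⟶ A.pow (n + 2)) ≫ A.e n =
      (quantumNumber η (n + 2) / quantumNumber η (n + 1)) • (A.jonesWenzlRight η n ≫ A.e n) ∧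
    (A.jonesWenzl η (n + 1) ▷ A.T : A.pow (n + 2) ⟶ A.pow (n + 2)) ≫ A.jonesWenzlRight η n =
      A.jonesWenzl η (n + 1) ▷ A.T := by
  have h0 : η ≠ 0 := by
    rintro rfl
    exact hn 1 one_pos (by omega) (by simp [quantumNumber])
  induction n with
  | zero =>
    have h1 := quantumNumber_one (hn 1 one_pos (by omega))
    have h2 := quantumNumber_rec h0 0
    have hz : quantumNumber η 0 = 0 := by simp [quantumNumber]
    rw [zero_add, h1, hz, mul_one, zero_add, zero_add] at h2
    refine ⟨Category.comp_id _, ?_, Category.comp_id _⟩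
    have h3 : (A.jonesWenzl η (0 + 1) ▷ A.T : A.pow 2 ⟶ A.pow 2) = 𝟙 (A.pow 2) := id_whiskerRight _ _
    have h4 : A.jonesWenzlRight η 0 = 𝟙 _ := rfl
    refine (congrArg (fun f => A.e 0 ≫ f ≫ A.e 0) h3).trans ?_
    change A.e 0 ≫ 𝟙 (A.pow 2) ≫ A.e 0 = (quantumNumber η 2 / quantumNumber η 1) • _
    rw [h4, Category.id_comp, e_e hA, h2, h1, div_one]
  | succ n ih =>
    obtain ⟨ihA, ihB, ihC⟩ := ih (fun m h h' => hn m h (by omega))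
    have hn1 := hn (n + 1) (by omega) (by omega)
    have hn2 := hn (n + 2) (by omega) (by omega)
    have hrec := quantumNumber_rec h0 (n + 1)
    obtain ⟨q, hq⟩ : ∃ q : A.pow (n + 2) ⟶ A.pow (n + 2), q = A.jonesWenzl η (n + 1) ▷ A.T :=
      ⟨_, rfl⟩
    have hqq : q ≫ q = q := by
      rw [hq]
      exact (comp_whiskerRight _ _ _).symm.trans (by rw [ihA])
    rw [← hq] at ihB ihC
    replace ihB : A.e n ≫ q ≫ A.e n =
      (quantumNumber η (n + 2) / quantumNumber η (n + 1)) • (A.jonesWenzlRight η n ≫ A.e n) := ihB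
    replace ihC : q ≫ A.jonesWenzlRight η n = q := ihC
    have hdef : A.jonesWenzl η (n + 2) =
        q - (quantumNumber η (n + 1) / quantumNumber η (n + 2)) • (q ≫ A.e n ≫ q) := by
      rw [hq]; rfl
    have hpq : A.jonesWenzl η (n + 2) ≫ q = A.jonesWenzl η (n + 2) := by
      rw [hdef]
      simp only [Preadditive.sub_comp, Linear.smul_comp, Category.assoc, hqq]
    refine ⟨?_, ?_, ?_⟩
    · change A.jonesWenzl η (n + 2) ≫ A.jonesWenzl η (n + 2) = A.jonesWenzl η (n + 2)
      rw [hdef]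
      refine step_aux (t := quantumNumber η (n + 2) / quantumNumber η (n + 1))
        (by field_simp) hqq ?_
      have h : q ≫ A.e n ≫ q ≫ A.e n ≫ q = q ≫ (A.e n ≫ q ≫ A.e n) ≫ q := by
        simp only [Category.assoc]
      rw [h, ihB]
      simp only [Linear.smul_comp, Linear.comp_smul, Category.assoc]
      rw [reassoc_of% ihC]
    · have hQ : (A.jonesWenzl η (n + 2) ▷ A.T : A.pow (n + 3) ⟶ A.pow (n + 3)) =
          A.jonesWenzlRight η (n + 1) -
            (quantumNumber η (n + 1) / quantumNumber η (n + 2)) •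
              (A.jonesWenzlRight η (n + 1) ≫ (A.e n ▷ A.T : A.pow (n + 3) ⟶ A.pow (n + 3)) ≫
                A.jonesWenzlRight η (n + 1)) := by
        have hR : A.jonesWenzlRight η (n + 1) = q ▷ A.T := by rw [hq]; rfl
        rw [hdef, hR]
        refine (sub_whiskerRight _ _ _).trans ?_
        congr 1
        refine (MonoidalLinear.smul_whiskerRight _ _ _).trans ?_
        congr 1
        exact (comp_whiskerRight _ _ _).trans (congrArg _ (comp_whiskerRight _ _ _))
      change A.e (n + 1) ≫ (A.jonesWenzl η (n + 2) ▷ A.T : A.pow (n + 3) ⟶ A.pow (n + 3)) ≫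
        A.e (n + 1) = _
      rw [hQ]
      refine trace_aux (κ := η + η⁻¹) ?_ ?_ (comm_e A n _) (e_e hA _) (tl_rel A n)
      · change _ = quantumNumber η (n + 1 + 2) / quantumNumber η (n + 2)
        rw [eq_div_iff hn2, sub_mul, div_mul_cancel₀ _ hn2]
        linear_combination hrec
      · exact (comp_whiskerRight _ _ _).symm.trans (congrArg (· ▷ A.T) (hq ▸ hqq))
    · change (A.jonesWenzl η (n + 2) ▷ A.T : A.pow (n + 3) ⟶ A.pow (n + 3)) ≫
        (A.jonesWenzl η (n + 1) ▷ A.T ▷ A.T : A.pow (n + 3) ⟶ A.pow (n + 3)) = _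
      rw [hq] at hpq
      exact (comp_whiskerRight _ _ _).symm.trans (congrArg (· ▷ A.T) hpq)

/-- The Jones-Wenzl projector `p_n` is idempotent if `[1], …, [n]` are non-zero. -/
theorem jonesWenzl_idem {η : k} (hA : A.HasDimension k (η + η⁻¹)) (n : ℕ)
    (hn : ∀ m, 0 < m → m ≤ n → quantumNumber η m ≠ 0) :
    A.jonesWenzl η n ≫ A.jonesWenzl η n = A.jonesWenzl η n := by
  cases n with
  | zero => exact Category.comp_id _
  | succ n => exact (jonesWenzl_aux hA n hn).1

end Idempotent

end SelfDualObject

/-! ## Temperley-Lieb categories -/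

/-- Objects of the tensor category (additive `k`-linear monoidal category with bilinear tensor
product) freely generated by a self-dual object of dimension `κ`: formal expressions in the
generating object, the unit, tensor products, the zero object and direct sums. -/
inductive FreeTL {k : Type u} (κ : k) : Type
  | unit : FreeTL κ
  | gen : FreeTL κ
  | tensor : FreeTL κ → FreeTL κ → FreeTL κ
  | zero : FreeTL κ
  | sum : FreeTL κ → FreeTL κ → FreeTL κ

namespace FreeTL

variable {k : Type u}

/-- Formal morphisms: `cup` and `cap` are the structure morphisms `n` and `u` of the generating
object; the other constructors are the operations of an additive `k`-linear monoidal category. -/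
inductive PreHom {κ : k} : FreeTL κ → FreeTL κ → Type u
  | cup : PreHom unit (tensor gen gen)
  | cap : PreHom (tensor gen gen) unit
  | ident (X : FreeTL κ) : PreHom X X
  | comp {X Y Z : FreeTL κ} (f : PreHom X Y) (g : PreHom Y Z) : PreHom X Z
  | tensorHom {X Y Z W : FreeTL κ} (f : PreHom X Y) (g : PreHom Z W) :
      PreHom (tensor X Z) (tensor Y W)
  | assocHom (X Y Z : FreeTL κ) : PreHom (tensor (tensor X Y) Z) (tensor X (tensor Y Z))
  | assocInv (X Y Z : FreeTL κ) : PreHom (tensor X (tensor Y Z)) (tensor (tensor X Y) Z)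
  | leftHom (X : FreeTL κ) : PreHom (tensor unit X) X
  | leftInv (X : FreeTL κ) : PreHom X (tensor unit X)
  | rightHom (X : FreeTL κ) : PreHom (tensor X unit) X
  | rightInv (X : FreeTL κ) : PreHom X (tensor X unit)
  | zeroHom (X Y : FreeTL κ) : PreHom X Y
  | add {X Y : FreeTL κ} (f g : PreHom X Y) : PreHom X Y
  | smul {X Y : FreeTL κ} (a : k) (f : PreHom X Y) : PreHom X Y
  | inl (X Y : FreeTL κ) : PreHom X (sum X Y)
  | inr (X Y : FreeTL κ) : PreHom Y (sum X Y)
  | fst (X Y : FreeTL κ) : PreHom (sum X Y) X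
  | snd (X Y : FreeTL κ) : PreHom (sum X Y) Y

open PreHom

/-- The congruence on formal morphisms generated by the axioms of an additive `k`-linear monoidal
category with bilinear tensor product, the zigzag identities for the generating object, and
`u ∘ n = κ 1_I`. -/
inductive Rel [Field k] {κ : k} : {X Y : FreeTL κ} → PreHom X Y → PreHom X Y → Prop
  -- the relation is a congruence
  | refl {X Y : FreeTL κ} (f : PreHom X Y) : Rel f f
  | symm {X Y : FreeTL κ} {f g : PreHom X Y} : Rel f g → Rel g f
  | trans {X Y : FreeTL κ} {f g h : PreHom X Y} : Rel f g → Rel g h → Rel f h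
  | comp_congr {X Y Z : FreeTL κ} {f f' : PreHom X Y} {g g' : PreHom Y Z} :
      Rel f f' → Rel g g' → Rel (comp f g) (comp f' g')
  | tensor_congr {X Y Z W : FreeTL κ} {f f' : PreHom X Y} {g g' : PreHom Z W} :
      Rel f f' → Rel g g' → Rel (tensorHom f g) (tensorHom f' g')
  | add_congr {X Y : FreeTL κ} {f f' g g' : PreHom X Y} :
      Rel f f' → Rel g g' → Rel (add f g) (add f' g')
  | smul_congr {X Y : FreeTL κ} (a : k) {f f' : PreHom X Y} :
      Rel f f' → Rel (smul a f) (smul a f')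
  -- axioms of a category
  | id_comp {X Y : FreeTL κ} (f : PreHom X Y) : Rel (comp (ident X) f) f
  | comp_id {X Y : FreeTL κ} (f : PreHom X Y) : Rel (comp f (ident Y)) f
  | assoc {X Y Z W : FreeTL κ} (f : PreHom X Y) (g : PreHom Y Z) (h : PreHom Z W) :
      Rel (comp (comp f g) h) (comp f (comp g h))
  -- axioms of a monoidal category
  | tensor_id (X Y : FreeTL κ) : Rel (tensorHom (ident X) (ident Y)) (ident (tensor X Y))
  | tensor_comp {X₁ Y₁ Z₁ X₂ Y₂ Z₂ : FreeTL κ} (f₁ : PreHom X₁ Y₁) (f₂ : PreHom X₂ Y₂)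
      (g₁ : PreHom Y₁ Z₁) (g₂ : PreHom Y₂ Z₂) :
      Rel (comp (tensorHom f₁ f₂) (tensorHom g₁ g₂)) (tensorHom (comp f₁ g₁) (comp f₂ g₂))
  | assoc_hom_inv (X Y Z : FreeTL κ) : Rel (comp (assocHom X Y Z) (assocInv X Y Z)) (ident _)
  | assoc_inv_hom (X Y Z : FreeTL κ) : Rel (comp (assocInv X Y Z) (assocHom X Y Z)) (ident _)
  | assoc_naturality {X₁ X₂ X₃ Y₁ Y₂ Y₃ : FreeTL κ} (f₁ : PreHom X₁ Y₁) (f₂ : PreHom X₂ Y₂)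
      (f₃ : PreHom X₃ Y₃) :
      Rel (comp (tensorHom (tensorHom f₁ f₂) f₃) (assocHom Y₁ Y₂ Y₃))
        (comp (assocHom X₁ X₂ X₃) (tensorHom f₁ (tensorHom f₂ f₃)))
  | left_hom_inv (X : FreeTL κ) : Rel (comp (leftHom X) (leftInv X)) (ident _)
  | left_inv_hom (X : FreeTL κ) : Rel (comp (leftInv X) (leftHom X)) (ident _)
  | left_naturality {X Y : FreeTL κ} (f : PreHom X Y) :
      Rel (comp (tensorHom (ident unit) f) (leftHom Y)) (comp (leftHom X) f)
  | right_hom_inv (X : FreeTL κ) : Rel (comp (rightHom X) (rightInv X)) (ident _)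
  | right_inv_hom (X : FreeTL κ) : Rel (comp (rightInv X) (rightHom X)) (ident _)
  | right_naturality {X Y : FreeTL κ} (f : PreHom X Y) :
      Rel (comp (tensorHom f (ident unit)) (rightHom Y)) (comp (rightHom X) f)
  | pentagon (X Y Z W : FreeTL κ) :
      Rel (comp (tensorHom (assocHom X Y Z) (ident W))
          (comp (assocHom X (tensor Y Z) W) (tensorHom (ident X) (assocHom Y Z W))))
        (comp (assocHom (tensor X Y) Z W) (assocHom X Y (tensor Z W)))
  | triangle (X Y : FreeTL κ) :
      Rel (comp (assocHom X unit Y) (tensorHom (ident X) (leftHom Y)))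
        (tensorHom (rightHom X) (ident Y))
  -- morphisms form vector spaces
  | add_assoc {X Y : FreeTL κ} (f g h : PreHom X Y) : Rel (add (add f g) h) (add f (add g h))
  | add_comm {X Y : FreeTL κ} (f g : PreHom X Y) : Rel (add f g) (add g f)
  | zero_add {X Y : FreeTL κ} (f : PreHom X Y) : Rel (add (zeroHom X Y) f) f
  | zero_smul {X Y : FreeTL κ} (f : PreHom X Y) : Rel (smul 0 f) (zeroHom X Y)
  | one_smul {X Y : FreeTL κ} (f : PreHom X Y) : Rel (smul 1 f) f
  | mul_smul {X Y : FreeTL κ} (a b : k) (f : PreHom X Y) :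
      Rel (smul (a * b) f) (smul a (smul b f))
  | smul_add {X Y : FreeTL κ} (a : k) (f g : PreHom X Y) :
      Rel (smul a (add f g)) (add (smul a f) (smul a g))
  | add_smul {X Y : FreeTL κ} (a b : k) (f : PreHom X Y) :
      Rel (smul (a + b) f) (add (smul a f) (smul b f))
  -- composition is bilinear
  | add_comp {X Y Z : FreeTL κ} (f f' : PreHom X Y) (g : PreHom Y Z) :
      Rel (comp (add f f') g) (add (comp f g) (comp f' g))
  | comp_add {X Y Z : FreeTL κ} (f : PreHom X Y) (g g' : PreHom Y Z) :
      Rel (comp f (add g g')) (add (comp f g) (comp f g'))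
  | smul_comp {X Y Z : FreeTL κ} (a : k) (f : PreHom X Y) (g : PreHom Y Z) :
      Rel (comp (smul a f) g) (smul a (comp f g))
  | comp_smul {X Y Z : FreeTL κ} (f : PreHom X Y) (a : k) (g : PreHom Y Z) :
      Rel (comp f (smul a g)) (smul a (comp f g))
  -- the tensor product is bilinear
  | add_tensor {X Y Z W : FreeTL κ} (f f' : PreHom X Y) (g : PreHom Z W) :
      Rel (tensorHom (add f f') g) (add (tensorHom f g) (tensorHom f' g))
  | tensor_add {X Y Z W : FreeTL κ} (f : PreHom X Y) (g g' : PreHom Z W) :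
      Rel (tensorHom f (add g g')) (add (tensorHom f g) (tensorHom f g'))
  | smul_tensor {X Y Z W : FreeTL κ} (a : k) (f : PreHom X Y) (g : PreHom Z W) :
      Rel (tensorHom (smul a f) g) (smul a (tensorHom f g))
  | tensor_smul {X Y Z W : FreeTL κ} (f : PreHom X Y) (a : k) (g : PreHom Z W) :
      Rel (tensorHom f (smul a g)) (smul a (tensorHom f g))
  -- zero object and direct sums
  | id_zero : Rel (ident zero) (zeroHom zero zero)
  | inl_fst (X Y : FreeTL κ) : Rel (comp (inl X Y) (fst X Y)) (ident X)
  | inl_snd (X Y : FreeTL κ) : Rel (comp (inl X Y) (snd X Y)) (zeroHom X Y)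
  | inr_fst (X Y : FreeTL κ) : Rel (comp (inr X Y) (fst X Y)) (zeroHom Y X)
  | inr_snd (X Y : FreeTL κ) : Rel (comp (inr X Y) (snd X Y)) (ident Y)
  | total (X Y : FreeTL κ) :
      Rel (add (comp (fst X Y) (inl X Y)) (comp (snd X Y) (inr X Y))) (ident (sum X Y))
  -- the generating object is self-dual of dimension `κ`
  | zigzag_left :
      Rel (comp (leftInv gen) (comp (tensorHom cup (ident gen)) (comp (assocHom gen gen gen)
        (comp (tensorHom (ident gen) cap) (rightHom gen))))) (ident gen)
  | zigzag_right :
      Rel (comp (rightInv gen) (comp (tensorHom (ident gen) cup) (comp (assocInv gen gen gen)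
        (comp (tensorHom cap (ident gen)) (leftHom gen))))) (ident gen)
  | dimension : Rel (comp cup cap) (smul κ (ident unit))

variable [Field k] {κ : k}

/-- Morphisms are formal morphisms modulo the relations. -/
def Hom (X Y : FreeTL κ) : Type u := Quot (Rel (X := X) (Y := Y))

/-- The class of a formal morphism. -/
def Hom.mk {X Y : FreeTL κ} (f : PreHom X Y) : Hom X Y := Quot.mk _ f

instance : Category.{u} (FreeTL κ) where
  Hom X Y := Hom X Y
  id X := Hom.mk (ident X)
  comp := Quot.map₂ comp (fun f _ _ h => .comp_congr (.refl f) h)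
    (fun _ _ g h => .comp_congr h (.refl g))
  id_comp := by rintro _ _ ⟨f⟩; exact Quot.sound (.id_comp f)
  comp_id := by rintro _ _ ⟨f⟩; exact Quot.sound (.comp_id f)
  assoc := by rintro _ _ _ _ ⟨f⟩ ⟨g⟩ ⟨h⟩; exact Quot.sound (.assoc f g h)

instance (X Y : FreeTL κ) : Zero (X ⟶ Y) := ⟨Hom.mk (zeroHom X Y)⟩

instance (X Y : FreeTL κ) : Add (X ⟶ Y) :=
  ⟨Quot.map₂ add (fun f _ _ h => .add_congr (.refl f) h) (fun _ _ g h => .add_congr h (.refl g))⟩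

instance (X Y : FreeTL κ) : Neg (X ⟶ Y) :=
  ⟨Quot.map (smul (-1)) (fun _ _ h => .smul_congr (-1) h)⟩

instance (X Y : FreeTL κ) : AddCommGroup (X ⟶ Y) where
  add_assoc := by rintro ⟨f⟩ ⟨g⟩ ⟨h⟩; exact Quot.sound (.add_assoc f g h)
  add_comm := by rintro ⟨f⟩ ⟨g⟩; exact Quot.sound (.add_comm f g)
  zero_add := by rintro ⟨f⟩; exact Quot.sound (.zero_add f)
  add_zero := by
    rintro ⟨f⟩; exact Quot.sound (.trans (.add_comm f (zeroHom X Y)) (.zero_add f))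
  neg_add_cancel := by
    rintro ⟨f⟩
    refine Quot.sound (.trans (.add_congr (.refl _) (.symm (.one_smul f))) ?_)
    refine .trans (.symm (.add_smul (-1) 1 f)) ?_
    rw [neg_add_cancel]
    exact .zero_smul f
  nsmul := nsmulRec
  zsmul := zsmulRec

instance : Preadditive (FreeTL κ) where
  homGroup X Y := inferInstance
  add_comp := by rintro _ _ _ ⟨f⟩ ⟨f'⟩ ⟨g⟩; exact Quot.sound (.add_comp f f' g)
  comp_add := by rintro _ _ _ ⟨f⟩ ⟨g⟩ ⟨g'⟩; exact Quot.sound (.comp_add f g g')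

instance (X Y : FreeTL κ) : Module k (X ⟶ Y) where
  smul a := Quot.map (smul a) (fun _ _ h => .smul_congr a h)
  one_smul := by rintro ⟨f⟩; exact Quot.sound (.one_smul f)
  mul_smul := by rintro a b ⟨f⟩; exact Quot.sound (.mul_smul a b f)
  smul_add := by rintro a ⟨f⟩ ⟨g⟩; exact Quot.sound (.smul_add a f g)
  add_smul := by rintro a b ⟨f⟩; exact Quot.sound (.add_smul a b f)
  zero_smul := by rintro ⟨f⟩; exact Quot.sound (.zero_smul f)
  smul_zero := by
    intro a
    refine Quot.sound (.trans (.smul_congr a (.symm (.zero_smul (zeroHom X Y)))) ?_)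
    refine .trans (.symm (.mul_smul a 0 _)) ?_
    rw [mul_zero]
    exact .zero_smul _

instance : Linear k (FreeTL κ) where
  homModule X Y := inferInstance
  smul_comp := by rintro _ _ _ a ⟨f⟩ ⟨g⟩; exact Quot.sound (.smul_comp a f g)
  comp_smul := by rintro _ _ _ ⟨f⟩ a ⟨g⟩; exact Quot.sound (.comp_smul f a g)

/-- Tensor product of morphisms. -/
def tensorMap {X Y Z W : FreeTL κ} : (X ⟶ Y) → (Z ⟶ W) → (tensor X Z ⟶ tensor Y W) :=
  Quot.map₂ tensorHom (fun f _ _ h => .tensor_congr (.refl f) h)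
    (fun _ _ g h => .tensor_congr h (.refl g))

instance : MonoidalCategoryStruct (FreeTL κ) where
  tensorObj X Y := tensor X Y
  tensorHom f g := tensorMap f g
  whiskerLeft X _ _ g := tensorMap (𝟙 X) g
  whiskerRight f Y := tensorMap f (𝟙 Y)
  tensorUnit := unit
  associator X Y Z := ⟨Hom.mk (assocHom X Y Z), Hom.mk (assocInv X Y Z),
    Quot.sound (.assoc_hom_inv X Y Z), Quot.sound (.assoc_inv_hom X Y Z)⟩
  leftUnitor X := ⟨Hom.mk (leftHom X), Hom.mk (leftInv X),
    Quot.sound (.left_hom_inv X), Quot.sound (.left_inv_hom X)⟩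
  rightUnitor X := ⟨Hom.mk (rightHom X), Hom.mk (rightInv X),
    Quot.sound (.right_hom_inv X), Quot.sound (.right_inv_hom X)⟩

instance : MonoidalCategory (FreeTL κ) := MonoidalCategory.ofTensorHom
  (id_tensorHom_id := fun X Y => Quot.sound (.tensor_id X Y))
  (id_tensorHom := fun _ _ _ _ => rfl)
  (tensorHom_id := fun _ _ => rfl)
  (tensorHom_comp_tensorHom := by
    rintro _ _ _ _ _ _ ⟨f₁⟩ ⟨f₂⟩ ⟨g₁⟩ ⟨g₂⟩; exact Quot.sound (.tensor_comp f₁ f₂ g₁ g₂))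
  (associator_naturality := by
    rintro _ _ _ _ _ _ ⟨f₁⟩ ⟨f₂⟩ ⟨f₃⟩; exact Quot.sound (.assoc_naturality f₁ f₂ f₃))
  (leftUnitor_naturality := by rintro _ _ ⟨f⟩; exact Quot.sound (.left_naturality f))
  (rightUnitor_naturality := by rintro _ _ ⟨f⟩; exact Quot.sound (.right_naturality f))
  (pentagon := fun X Y Z W => Quot.sound (.pentagon X Y Z W))
  (triangle := fun X Y => Quot.sound (.triangle X Y))

theorem tensorMap_add {X Y Z W : FreeTL κ} (f : X ⟶ Y) (g g' : Z ⟶ W) :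
    tensorMap f (g + g') = tensorMap f g + tensorMap f g' := by
  obtain ⟨f⟩ := f; obtain ⟨g⟩ := g; obtain ⟨g'⟩ := g'
  exact Quot.sound (.tensor_add f g g')

theorem add_tensorMap {X Y Z W : FreeTL κ} (f f' : X ⟶ Y) (g : Z ⟶ W) :
    tensorMap (f + f') g = tensorMap f g + tensorMap f' g := by
  obtain ⟨f⟩ := f; obtain ⟨f'⟩ := f'; obtain ⟨g⟩ := g
  exact Quot.sound (.add_tensor f f' g)

theorem tensorMap_smul {X Y Z W : FreeTL κ} (f : X ⟶ Y) (a : k) (g : Z ⟶ W) :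
    tensorMap f (a • g) = a • tensorMap f g := by
  obtain ⟨f⟩ := f; obtain ⟨g⟩ := g
  exact Quot.sound (.tensor_smul f a g)

theorem smul_tensorMap {X Y Z W : FreeTL κ} (a : k) (f : X ⟶ Y) (g : Z ⟶ W) :
    tensorMap (a • f) g = a • tensorMap f g := by
  obtain ⟨f⟩ := f; obtain ⟨g⟩ := g
  exact Quot.sound (.smul_tensor a f g)

instance : MonoidalPreadditive (FreeTL κ) where
  whiskerLeft_add f g := tensorMap_add _ f g
  add_whiskerRight f g := add_tensorMap f g _
  whiskerLeft_zero {X Y Z} := by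
    have h := tensorMap_smul (𝟙 X) (0 : k) (0 : Y ⟶ Z)
    rw [zero_smul, zero_smul] at h
    exact h
  zero_whiskerRight {X Y Z} := by
    have h := smul_tensorMap (0 : k) (0 : Y ⟶ Z) (𝟙 X)
    rw [zero_smul, zero_smul] at h
    exact h

instance : MonoidalLinear k (FreeTL κ) where
  whiskerLeft_smul _ _ _ a f := tensorMap_smul _ a f
  smul_whiskerRight a _ _ f _ := smul_tensorMap a f _

instance : HasZeroObject (FreeTL κ) :=
  ⟨zero, (IsZero.iff_id_eq_zero _).mpr (Quot.sound .id_zero)⟩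

instance : HasBinaryBiproducts (FreeTL κ) where
  has_binary_biproduct X Y := hasBinaryBiproduct_of_total
    { pt := sum X Y
      fst := Hom.mk (fst X Y)
      snd := Hom.mk (snd X Y)
      inl := Hom.mk (inl X Y)
      inr := Hom.mk (inr X Y)
      inl_fst := Quot.sound (.inl_fst X Y)
      inl_snd := Quot.sound (.inl_snd X Y)
      inr_fst := Quot.sound (.inr_fst X Y)
      inr_snd := Quot.sound (.inr_snd X Y) }
    (Quot.sound (.total X Y))

/-- The free tensor category has finite direct sums. -/
instance : HasFiniteBiproducts (FreeTL κ) :=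
  haveI : HasFiniteProducts (FreeTL κ) := hasFiniteProducts_of_has_binary_and_terminal
  HasFiniteBiproducts.of_hasFiniteProducts

variable (κ) in
/-- The generating self-dual object. -/
def generator : SelfDualObject (FreeTL κ) where
  T := gen
  n := Hom.mk cup
  u := Hom.mk cap
  zigzag_left := Quot.sound .zigzag_left
  zigzag_right := Quot.sound .zigzag_right

theorem generator_hasDimension : (generator κ).HasDimension k κ :=
  Quot.sound .dimension

end FreeTL

/-- The Temperley-Lieb category: the idempotent completion of the tensor category freely
generated by a self-dual object of dimension `κ`. -/
abbrev TemperleyLieb {k : Type u} [Field k] (κ : k) : Type u :=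
  Idempotents.Karoubi (FreeTL κ)

namespace TemperleyLieb

variable {k : Type u} [Field k]

/-- The object `T_n` of the Temperley-Lieb category for `κ = η + η⁻¹`: the image of the
Jones-Wenzl projector `p_n`, for `n` such that `[1], …, [n]` are non-zero. -/
def T (κ η : k) (hκ : κ = η + η⁻¹) (n : ℕ)
    (hn : ∀ m, 0 < m → m ≤ n → quantumNumber η m ≠ 0) : TemperleyLieb κ where
  X := (FreeTL.generator κ).pow n
  p := (FreeTL.generator κ).jonesWenzl η n
  idem := SelfDualObject.jonesWenzl_idem (hκ ▸ FreeTL.generator_hasDimension) n hn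

/-- The Jones-Wenzl projector `p_n` as an endomorphism of the `n`-th tensor power of the generator
of the Temperley-Lieb category. -/
def p (κ η : k) (n : ℕ) :
    (Idempotents.toKaroubi (FreeTL κ)).obj ((FreeTL.generator κ).pow n) ⟶
      (Idempotents.toKaroubi (FreeTL κ)).obj ((FreeTL.generator κ).pow n) :=
  (Idempotents.toKaroubi (FreeTL κ)).map ((FreeTL.generator κ).jonesWenzl η n)

end TemperleyLieb

/-! ## Tensor ideals and quotients -/

/-- `InTensorIdeal p f` : the morphism `f` lies in the ideal of morphisms tensor generated by `p`,
that is, in the smallest class of morphisms which contains `p` and is closed under sums,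
under composition with arbitrary morphisms, and under tensor product with arbitrary objects. -/
inductive InTensorIdeal {C : Type*} [Category* C] [Preadditive C] [MonoidalCategory C] {A B : C}
    (p : A ⟶ B) : {X Y : C} → (X ⟶ Y) → Prop
  | gen : InTensorIdeal p p
  | zero (X Y : C) : InTensorIdeal p (0 : X ⟶ Y)
  | add {X Y : C} {f g : X ⟶ Y} : InTensorIdeal p f → InTensorIdeal p g → InTensorIdeal p (f + g)
  | comp_left {X Y Z : C} (f : X ⟶ Y) {g : Y ⟶ Z} : InTensorIdeal p g → InTensorIdeal p (f ≫ g)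
  | comp_right {X Y Z : C} {f : X ⟶ Y} (g : Y ⟶ Z) : InTensorIdeal p f → InTensorIdeal p (f ≫ g)
  | whiskerLeft (Z : C) {X Y : C} {f : X ⟶ Y} : InTensorIdeal p f → InTensorIdeal p (Z ◁ f)
  | whiskerRight {X Y : C} {f : X ⟶ Y} (Z : C) : InTensorIdeal p f → InTensorIdeal p (f ▷ Z)

section Quotient

variable {C : Type*} [Category* C] [Preadditive C] [MonoidalCategory C] {A B : C} (p : A ⟶ B)

theorem InTensorIdeal.neg {p : A ⟶ B} {X Y : C} {f : X ⟶ Y} (h : InTensorIdeal p f) :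
    InTensorIdeal p (-f) := by
  simpa using h.comp_left (-𝟙 X)

/-- Congruence modulo the tensor ideal generated by `p`. -/
def tensorIdealRel : HomRel C := fun _ _ f g => InTensorIdeal p (f - g)

instance : Congruence (tensorIdealRel p) where
  equivalence :=
    { refl := fun f => by
        change InTensorIdeal p (f - f)
        rw [sub_self]
        exact .zero _ _
      symm := fun {f g} h => by
        change InTensorIdeal p (g - f)
        rw [← neg_sub]
        exact InTensorIdeal.neg h
      trans := fun {f g h} h₁ h₂ => by
        change InTensorIdeal p (f - h)
        rw [← sub_add_sub_cancel f g h]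
        exact .add h₁ h₂ }
  comp_left {_ _ _} f {g g'} h := by
    change InTensorIdeal p (f ≫ g - f ≫ g')
    rw [← Preadditive.comp_sub]
    exact .comp_left f h
  comp_right {_ _ _ f f'} g h := by
    change InTensorIdeal p (f ≫ g - f' ≫ g)
    rw [← Preadditive.sub_comp]
    exact .comp_right g h

theorem tensorIdealRel_add ⦃X Y : C⦄ (f₁ f₂ g₁ g₂ : X ⟶ Y) (h₁ : tensorIdealRel p f₁ f₂)
    (h₂ : tensorIdealRel p g₁ g₂) : tensorIdealRel p (f₁ + g₁) (f₂ + g₂) := by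
  change InTensorIdeal p (f₁ + g₁ - (f₂ + g₂))
  rw [add_sub_add_comm]
  exact .add h₁ h₂

theorem tensorIdealRel_smul {R : Type*} [Semiring R] [Linear R C] (a : R) ⦃X Y : C⦄
    (f₁ f₂ : X ⟶ Y) (h : tensorIdealRel p f₁ f₂) : tensorIdealRel p (a • f₁) (a • f₂) := by
  change InTensorIdeal p (a • f₁ - a • f₂)
  have e : a • f₁ - a • f₂ = (a • 𝟙 X) ≫ (f₁ - f₂) := by simp
  rw [e]
  exact .comp_left _ h

/-- The quotient `C / ⟨p⟩` of a tensor category by the tensor ideal generated by `p`. -/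
abbrev TensorQuotient := CategoryTheory.Quotient (tensorIdealRel p)

namespace TensorQuotient

/-- The projection onto the quotient by a tensor ideal. -/
abbrev proj : C ⥤ TensorQuotient p := CategoryTheory.Quotient.functor (tensorIdealRel p)

instance : Preadditive (TensorQuotient p) :=
  CategoryTheory.Quotient.preadditive _ (tensorIdealRel_add p)

instance : (proj p).Additive :=
  CategoryTheory.Quotient.functor_additive _ (tensorIdealRel_add p)

variable {R : Type*} [Semiring R] [Linear R C]

instance : Linear R (TensorQuotient p) :=
  CategoryTheory.Quotient.linear R _ (tensorIdealRel_smul p)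

instance : (proj p).Linear R :=
  CategoryTheory.Quotient.linear_functor R _ (tensorIdealRel_smul p)

section Monoidal

variable [MonoidalPreadditive C]

theorem rel_whiskerLeft (Z : C) {X Y : C} {f g : X ⟶ Y} (h : tensorIdealRel p f g) :
    tensorIdealRel p (Z ◁ f) (Z ◁ g) := by
  change InTensorIdeal p (Z ◁ f - Z ◁ g)
  have e : Z ◁ f - Z ◁ g = Z ◁ (f - g) := ((tensorLeft Z).map_sub).symm
  rw [e]
  exact .whiskerLeft Z h

theorem rel_whiskerRight (Z : C) {X Y : C} {f g : X ⟶ Y} (h : tensorIdealRel p f g) :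
    tensorIdealRel p (f ▷ Z) (g ▷ Z) := by
  change InTensorIdeal p (f ▷ Z - g ▷ Z)
  have e : f ▷ Z - g ▷ Z = (f - g) ▷ Z := ((tensorRight Z).map_sub).symm
  rw [e]
  exact .whiskerRight Z h

/-- Tensor product with an object on the left, on the quotient. -/
def whiskerLeftFunctor (Z : C) : TensorQuotient p ⥤ TensorQuotient p :=
  CategoryTheory.Quotient.lift _ (tensorLeft Z ⋙ proj p)
    (fun _ _ _ _ h => CategoryTheory.Quotient.sound _ (rel_whiskerLeft p Z h))

/-- Tensor product with an object on the right, on the quotient. -/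
def whiskerRightFunctor (Z : C) : TensorQuotient p ⥤ TensorQuotient p :=
  CategoryTheory.Quotient.lift _ (tensorRight Z ⋙ proj p)
    (fun _ _ _ _ h => CategoryTheory.Quotient.sound _ (rel_whiskerRight p Z h))

instance : MonoidalCategoryStruct (TensorQuotient p) where
  tensorObj X Y := (proj p).obj (X.as ⊗ Y.as)
  whiskerLeft X _ _ g := (whiskerLeftFunctor p X.as).map g
  whiskerRight f Y := (whiskerRightFunctor p Y.as).map f
  tensorUnit := (proj p).obj (𝟙_ C)
  associator X Y Z := (proj p).mapIso (α_ X.as Y.as Z.as)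
  leftUnitor X := (proj p).mapIso (λ_ X.as)
  rightUnitor X := (proj p).mapIso (ρ_ X.as)
  tensorHom {_ Y₁ X₂ _} f g :=
    (whiskerRightFunctor p X₂.as).map f ≫ (whiskerLeftFunctor p Y₁.as).map g

theorem whiskerLeft_map (X : C) {Y Z : C} (f : Y ⟶ Z) :
    (proj p).obj X ◁ (proj p).map f = (proj p).map (X ◁ f) := rfl

theorem map_whiskerRight {X Y : C} (f : X ⟶ Y) (Z : C) :
    (proj p).map f ▷ (proj p).obj Z = (proj p).map (f ▷ Z) := rfl

theorem map_tensorHom {X Y Z W : C} (f : X ⟶ Y) (g : Z ⟶ W) :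
    (proj p).map f ⊗ₘ (proj p).map g = (proj p).map (f ⊗ₘ g) := by
  rw [MonoidalCategory.tensorHom_def, Functor.map_comp]
  rfl

instance : MonoidalCategory (TensorQuotient p) where
  tensorHom_def _ _ := rfl
  id_tensorHom_id X Y := by
    have h : 𝟙 X.as ▷ Y.as ≫ X.as ◁ 𝟙 Y.as = 𝟙 (X.as ⊗ Y.as) := by simp
    exact congrArg (fun t => (proj p).map t) h
  tensorHom_comp_tensorHom := by
    rintro _ _ _ _ _ _ ⟨f₁⟩ ⟨f₂⟩ ⟨g₁⟩ ⟨g₂⟩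
    have h := tensorHom_comp_tensorHom f₁ f₂ g₁ g₂
    simp only [MonoidalCategory.tensorHom_def] at h
    exact congrArg (fun t => (proj p).map t) h
  whiskerLeft_id X Y := congrArg (fun t => (proj p).map t) (whiskerLeft_id X.as Y.as)
  id_whiskerRight X Y := congrArg (fun t => (proj p).map t) (id_whiskerRight X.as Y.as)
  associator_naturality := by
    rintro _ _ _ _ _ _ ⟨f₁⟩ ⟨f₂⟩ ⟨f₃⟩
    have h := associator_naturality f₁ f₂ f₃
    simp only [MonoidalCategory.tensorHom_def] at h
    exact congrArg (fun t => (proj p).map t) h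
  leftUnitor_naturality := by
    rintro _ _ ⟨f⟩; exact congrArg (fun t => (proj p).map t) (leftUnitor_naturality f)
  rightUnitor_naturality := by
    rintro _ _ ⟨f⟩; exact congrArg (fun t => (proj p).map t) (rightUnitor_naturality f)
  pentagon X Y Z W := congrArg (fun t => (proj p).map t) (pentagon X.as Y.as Z.as W.as)
  triangle X Y := congrArg (fun t => (proj p).map t) (triangle X.as Y.as)

/-- The projection is a strict monoidal functor. -/
instance : (proj p).Monoidal := Functor.CoreMonoidal.toMonoidal
  { εIso := Iso.refl _
    μIso := fun _ _ => Iso.refl _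
    μIso_hom_natural_left := fun {X Y} f Z => by
      have h : f ▷ Z ≫ 𝟙 (Y ⊗ Z) = 𝟙 (X ⊗ Z) ≫ f ▷ Z := by simp
      exact congrArg (fun t => (proj p).map t) h
    μIso_hom_natural_right := fun {X Y} Z f => by
      have h : Z ◁ f ≫ 𝟙 (Z ⊗ Y) = 𝟙 (Z ⊗ X) ≫ Z ◁ f := by simp
      exact congrArg (fun t => (proj p).map t) h
    associativity := fun X Y Z => by
      have h : 𝟙 (X ⊗ Y) ▷ Z ≫ 𝟙 ((X ⊗ Y) ⊗ Z) ≫ (α_ X Y Z).hom =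
          (α_ X Y Z).hom ≫ X ◁ 𝟙 (Y ⊗ Z) ≫ 𝟙 (X ⊗ Y ⊗ Z) := by simp
      exact congrArg (fun t => (proj p).map t) h
    left_unitality := fun X => by
      have h : (λ_ X).hom = 𝟙 (𝟙_ C) ▷ X ≫ 𝟙 (𝟙_ C ⊗ X) ≫ (λ_ X).hom := by simp
      exact congrArg (fun t => (proj p).map t) h
    right_unitality := fun X => by
      have h : (ρ_ X).hom = X ◁ 𝟙 (𝟙_ C) ≫ 𝟙 (X ⊗ 𝟙_ C) ≫ (ρ_ X).hom := by simp
      exact congrArg (fun t => (proj p).map t) h }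

instance : MonoidalPreadditive (TensorQuotient p) where
  whiskerLeft_zero {X Y Z} :=
    congrArg (fun t => (proj p).map t) (MonoidalPreadditive.whiskerLeft_zero (X := X.as))
  zero_whiskerRight {X Y Z} :=
    congrArg (fun t => (proj p).map t) (MonoidalPreadditive.zero_whiskerRight (X := X.as))
  whiskerLeft_add := by
    rintro _ _ _ ⟨f⟩ ⟨g⟩
    exact congrArg (fun t => (proj p).map t) (MonoidalPreadditive.whiskerLeft_add f g)
  add_whiskerRight := by
    rintro _ _ _ ⟨f⟩ ⟨g⟩
    exact congrArg (fun t => (proj p).map t) (MonoidalPreadditive.add_whiskerRight f g)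

instance [MonoidalLinear R C] : MonoidalLinear R (TensorQuotient p) where
  whiskerLeft_smul := by
    rintro X _ _ a ⟨f⟩
    exact congrArg (fun t => (proj p).map t) (MonoidalLinear.whiskerLeft_smul X.as a f)
  smul_whiskerRight := by
    rintro a _ _ ⟨f⟩ X
    exact congrArg (fun t => (proj p).map t) (MonoidalLinear.smul_whiskerRight a f X.as)

end Monoidal

end TensorQuotient

end Quotient


/-- The quotient `T_κ = TL_κ / ⟨p_{d-1}⟩` for `κ = η + η⁻¹`, where `d` is the order of `η` if this
is odd, and half the order of `η` if it is even. -/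
noncomputable abbrev TLQuotient {k : Type u} [Field k] (κ η : k) : Type u :=
  TensorQuotient (TemperleyLieb.p κ η (quantumOrder η - 1))

/-- The projection `TL_κ → T_κ`. -/
noncomputable abbrev TLQuotient.proj {k : Type u} [Field k] (κ η : k) : TemperleyLieb κ ⥤ TLQuotient κ η :=
  TensorQuotient.proj (TemperleyLieb.p κ η (quantumOrder η - 1))

/-! ## Fusion categories -/

section

attribute [local instance] Abelian.hasFiniteBiproducts

/-- A fusion category over `k`: a `k`-linear abelian monoidal category with bilinear tensor product
which is semisimple (every object is a finite direct sum of simple objects), with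
finite-dimensional morphism spaces, finitely many isomorphism classes of simple objects, and a
simple unit object. -/
class IsFusionCategory (k : Type*) [Field k] (D : Type*) [Category* D] [Abelian D] [Linear k D]
    [MonoidalCategory D] [MonoidalPreadditive D] [MonoidalLinear k D] : Prop where
  semisimple : ∀ X : D, ∃ (n : ℕ) (Y : Fin n → D), (∀ i, Simple (Y i)) ∧ Nonempty (X ≅ ⨁ Y)
  finite_hom : ∀ X Y : D, Module.Finite k (X ⟶ Y)
  finite_simples : ∃ (n : ℕ) (Y : Fin n → D), ∀ X : D, Simple X → ∃ i, Nonempty (X ≅ Y i)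
  simple_unit : Simple (𝟙_ D)

end

/-- `S 0, …, S (d - 2)` is a complete list of the simple objects, without repetitions up to
isomorphism, and it satisfies the truncated Temperley-Lieb fusion rules
`S_1 ⊗ S_i ≅ S_{i-1} ⊕ S_{i+1}` for `0 < i < d - 2` and `S_1 ⊗ S_{d-2} ≅ S_{d-3}`.
(The values `S i` with `i > d - 2` play no role.) -/
structure HasTLFusionRules {D : Type*} [Category* D] [Abelian D] [MonoidalCategory D]
    (d : ℕ) (S : ℕ → D) : Prop where
  simple : ∀ i ≤ d - 2, Simple (S i)
  complete : ∀ X : D, Simple X → ∃ i ≤ d - 2, Nonempty (X ≅ S i)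
  distinct : ∀ i ≤ d - 2, ∀ j ≤ d - 2, Nonempty (S i ≅ S j) → i = j
  fusion : ∀ i, 0 < i → i < d - 2 → Nonempty (S 1 ⊗ S i ≅ S (i - 1) ⊞ S (i + 1))
  fusion_last : Nonempty (S 1 ⊗ S (d - 2) ≅ S (d - 3))

/-! The quotient by a tensor ideal has the expected universal property: an additive monoidal functor
that kills the generator kills the whole ideal, hence descends. So everything rests on `F(p_{d-1}) =
0`, and since `p_{d-1}` factors through its image `T_{d-1}`, it is enough that `F(T_{d-1})` be a
zero object (`map_toKaroubi_p_eq_zero`).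

In the Temperley-Lieb category `T_{d-2} ⊗ T_1 ≅ T_{d-3} ⊕ T_{d-1}` (`isDirectSum_T_tensor_T_one`).
The recursion for the Jones-Wenzl projectors writes `p_{m+1} ⊗ 1` as `p_{m+2}` plus a term factoring
through `T_m`, and the partial trace `[m+2]/[m+1]` of `p_{m+1}` makes that term the projection onto
a copy of `T_m`. Applying `F` gives `S_{d-2} ⊗ S_1 ≅ S_{d-3} ⊕ F(T_{d-1})`. If the left side could
be replaced by `S_1 ⊗ S_{d-2} ≅ S_{d-3}`, nothing would be left for `F(T_{d-1})`.

The two orders of tensoring have to be compared without a braiding on `D`. Dimensions of morphism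
spaces suffice: expanding `S_1 ⊗ S_{i+1} ⊗ S_1` from the left and from the right shows, by induction
in steps of two, that `S_i ⊗ S_1` and `S_1 ⊗ S_i` receive equally many morphisms from any object `W`
(`finrank_hom_tensor_comm`). Taking `W = F(T_{d-1})` forces `dim End(W) = 0`, hence `W = 0`. -/

/-! ### Universal property of the quotient by a tensor ideal -/

section Factorization

variable {C : Type*} [Category* C] [Preadditive C] [MonoidalCategory C]
  {D : Type*} [Category* D] [Preadditive D] [MonoidalCategory D] [MonoidalPreadditive D]

/-- An additive monoidal functor which kills `p` kills the tensor ideal generated by `p`. -/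
theorem InTensorIdeal.map_eq_zero {A B : C} {p : A ⟶ B} (F : C ⥤ D) [F.Additive] [F.Monoidal]
    (hp : F.map p = 0) {X Y : C} {f : X ⟶ Y} (hf : InTensorIdeal p f) : F.map f = 0 := by
  induction hf with
  | gen => exact hp
  | zero X Y => exact F.map_zero X Y
  | add _ _ h₁ h₂ => rw [F.map_add, h₁, h₂, add_zero]
  | comp_left f _ h => rw [F.map_comp, h, comp_zero]
  | comp_right g _ h => rw [F.map_comp, h, zero_comp]
  | whiskerLeft Z _ h => rw [Functor.Monoidal.map_whiskerLeft, h]; simp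
  | whiskerRight Z _ h => rw [Functor.Monoidal.map_whiskerRight, h]; simp

namespace TensorQuotient

variable [MonoidalPreadditive C] {A B : C} {p : A ⟶ B}

/-- The functor induced on the quotient by an additive monoidal functor which kills `p`. -/
def lift (F : C ⥤ D) [F.Additive] [F.Monoidal] (hp : F.map p = 0) : TensorQuotient p ⥤ D :=
  CategoryTheory.Quotient.lift _ F fun _ _ _ _ h =>
    -- Congruent morphisms differ by an element of the ideal, and `F` kills the difference.
    sub_eq_zero.mp (F.map_sub.symm.trans (InTensorIdeal.map_eq_zero F hp h))

variable (F : C ⥤ D) [F.Additive] [F.Monoidal] (hp : F.map p = 0)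

instance : (lift F hp).Additive where
  map_add := by
    rintro _ _ ⟨f⟩ ⟨g⟩
    exact F.map_add

instance {R : Type*} [Semiring R] [Linear R C] [Linear R D] [F.Linear R] :
    (lift F hp).Linear R where
  map_smul := by
    rintro _ _ ⟨f⟩ r
    exact Functor.Linear.map_smul f r

-- On objects the induced functor is `F`, and every morphism of the quotient is the class of a
-- morphism of `C`; so the structure isomorphisms of `F` and their axioms serve unchanged.
open Functor.LaxMonoidal Functor.OplaxMonoidal in
instance : (lift F hp).Monoidal := Functor.CoreMonoidal.toMonoidal
  { εIso := Functor.Monoidal.εIso F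
    μIso := fun X Y => Functor.Monoidal.μIso F X.as Y.as
    μIso_hom_natural_left := by
      rintro _ _ ⟨f⟩ Z
      exact μ_natural_left F f Z.as
    μIso_hom_natural_right := by
      rintro _ _ Z ⟨f⟩
      exact μ_natural_right F Z.as f
    associativity := fun X Y Z => associativity F X.as Y.as Z.as
    left_unitality := fun X => left_unitality F X.as
    right_unitality := fun X => right_unitality F X.as }

/-- The functor induced on the quotient restricts to the original functor. -/
def projCompLift : proj p ⋙ lift F hp ≅ F := CategoryTheory.Quotient.lift.isLift _ _ _

instance : NatTrans.IsMonoidal (projCompLift F hp).hom where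
  unit := by
    -- The structure maps of the projection and the components of the isomorphism are identities, so
    -- only those of `F` survive.
    change (Functor.LaxMonoidal.ε F ≫ F.map (𝟙 _)) ≫ 𝟙 _ = Functor.LaxMonoidal.ε F
    simp
  tensor X Y := by
    change (Functor.LaxMonoidal.μ F X Y ≫ F.map (𝟙 _)) ≫ 𝟙 _ =
      (𝟙 (F.obj X) ⊗ₘ 𝟙 (F.obj Y)) ≫ Functor.LaxMonoidal.μ F X Y
    simp

end TensorQuotient

end Factorization

/-! ### Dimensions of morphism spaces -/

section HomDimension

variable (k : Type*) [Field k] {D : Type*} [Category* D] [Preadditive D] [Linear k D]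

theorem finrank_hom_congr (W : D) {X Y : D} (e : X ≅ Y) :
    Module.finrank k (W ⟶ X) = Module.finrank k (W ⟶ Y) :=
  (Linear.homCongr k (Iso.refl W) e).finrank_eq

theorem finrank_hom_biprod [HasBinaryBiproducts D] (W X Y : D) [Module.Finite k (W ⟶ X)]
    [Module.Finite k (W ⟶ Y)] :
    Module.finrank k (W ⟶ X ⊞ Y) = Module.finrank k (W ⟶ X) + Module.finrank k (W ⟶ Y) := by
  rw [← Module.finrank_prod]
  exact LinearEquiv.finrank_eq
    { toFun := fun f => (f ≫ biprod.fst, f ≫ biprod.snd)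
      invFun := fun f => biprod.lift f.1 f.2
      left_inv := fun f => by ext <;> simp
      right_inv := fun f => by simp
      map_add' := fun f g => by simp
      map_smul' := fun r f => by simp }

end HomDimension

/-! ### Direct sums given by equations, and splittings of idempotents -/

section DirectSum

/-- `X` is a direct sum of `Y` and `Z`. -/
def IsDirectSum {D : Type*} [Category* D] [Preadditive D] (X Y Z : D) : Prop :=
  ∃ (i : Y ⟶ X) (r : X ⟶ Y) (j : Z ⟶ X) (s : X ⟶ Z),
    i ≫ r = 𝟙 Y ∧ j ≫ s = 𝟙 Z ∧ r ≫ i + s ≫ j = 𝟙 X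

variable {D : Type*} [Category* D] [Preadditive D] {X Y Z : D}

/-- The orthogonality relations missing from the definition follow from the others: composing `r ≫ i
+ s ≫ j = 𝟙` with `i` and `s` gives `i ≫ s + i ≫ s = i ≫ s`, so `i ≫ s = 0`, and likewise `j ≫ r =
0`. -/
theorem IsDirectSum.nonempty_iso [HasBinaryBiproducts D] (h : IsDirectSum X Y Z) :
    Nonempty (X ≅ Y ⊞ Z) := by
  obtain ⟨i, r, j, s, hi, hj, h⟩ := h
  have his : i ≫ s = 0 := by
    have := congrArg (fun f => i ≫ f ≫ s) h
    simpa [reassoc_of% hi, hj] using this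
  have hjr : j ≫ r = 0 := by
    have := congrArg (fun f => j ≫ f ≫ r) h
    simpa [reassoc_of% hj, hi] using this
  exact ⟨⟨biprod.lift r s, biprod.desc i j, by simpa using h, by ext <;> simp [*]⟩⟩

/-- Being purely equational, the notion passes through any additive functor without assuming
biproducts in the source. -/
theorem IsDirectSum.map (h : IsDirectSum X Y Z) {E : Type*} [Category* E] [Preadditive E]
    (F : D ⥤ E) [F.Additive] : IsDirectSum (F.obj X) (F.obj Y) (F.obj Z) := by
  obtain ⟨i, r, j, s, hi, hj, h⟩ := h
  refine ⟨F.map i, F.map r, F.map j, F.map s, ?_, ?_, ?_⟩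
  · rw [← F.map_comp, hi, F.map_id]
  · rw [← F.map_comp, hj, F.map_id]
  · rw [← F.map_comp, ← F.map_comp, ← F.map_add, h, F.map_id]

/-- A decomposition `q = b ≫ a + r` of an idempotent splits the image of `q`. -/
theorem isDirectSum_karoubi {A B : D} {p : A ⟶ A} {q r : B ⟶ B} (hp : p ≫ p = p)
    (hq : q ≫ q = q) (hr : r ≫ r = r) (hqr : q ≫ r = r) (hrq : r ≫ q = r) (a : A ⟶ B) (b : B ⟶ A)
    (hpa : p ≫ a = a) (haq : a ≫ q = a) (hqb : q ≫ b = b) (hbp : b ≫ p = b) (hab : a ≫ b = p)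
    (h : b ≫ a + r = q) :
    IsDirectSum (⟨B, q, hq⟩ : Idempotents.Karoubi D) ⟨A, p, hp⟩ ⟨B, r, hr⟩ := by
  -- The second summand lives on the same object `B`, so `r` is both its inclusion and its
  -- retraction; the identity of `(B, q)` is `q`, which makes the last equation `b ≫ a + r = q`.
  refine ⟨⟨a, ?_⟩, ⟨b, ?_⟩, ⟨r, ?_⟩, ⟨r, ?_⟩, ?_, ?_, ?_⟩
  any_goals ext
  all_goals simp [*]

end DirectSum

namespace SelfDualObject

/-! ### Cups and caps on the last two strands -/

section CupCap

variable {C : Type*} [Category* C] [MonoidalCategory C] (A : SelfDualObject C)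

/-- `1 ⊗ n` from the tensor power `T ^ ⊗ m` to `T ^ ⊗ (m + 2)`. -/
def cup : (m : ℕ) → (A.pow m ⟶ A.pow (m + 2))
  -- The empty power is separate because `pow 2` is `T ⊗ T`, not `(I ⊗ T) ⊗ T`.
  | 0 => A.n
  | m + 1 => (ρ_ (A.pow (m + 1))).inv ≫ A.pow (m + 1) ◁ A.n ≫ (α_ (A.pow (m + 1)) A.T A.T).inv

/-- `1 ⊗ u` from the tensor power `T ^ ⊗ (m + 2)` to `T ^ ⊗ m`. -/
def cap : (m : ℕ) → (A.pow (m + 2) ⟶ A.pow m)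
  | 0 => A.u
  | m + 1 => (α_ (A.pow (m + 1)) A.T A.T).hom ≫ A.pow (m + 1) ◁ A.u ≫ (ρ_ (A.pow (m + 1))).hom

theorem cap_cup_aux {P T : C} (n : 𝟙_ C ⟶ T ⊗ T) (u : T ⊗ T ⟶ 𝟙_ C) :
    ((α_ P T T).hom ≫ P ◁ u ≫ (ρ_ P).hom) ≫ (ρ_ P).inv ≫ P ◁ n ≫ (α_ P T T).inv =
      (α_ P T T).hom ≫ P ◁ (u ≫ n) ≫ (α_ P T T).inv := by
  simp

theorem cap_cup (m : ℕ) : A.cap m ≫ A.cup m = A.e m := by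
  cases m with
  | zero => rfl
  | succ m => exact cap_cup_aux A.n A.u

theorem comm_cap_aux {P T : C} (f : P ⟶ P) (u : T ⊗ T ⟶ 𝟙_ C) :
    f ▷ T ▷ T ≫ (α_ P T T).hom ≫ P ◁ u ≫ (ρ_ P).hom =
      ((α_ P T T).hom ≫ P ◁ u ≫ (ρ_ P).hom) ≫ f := by
  rw [associator_naturality_left_assoc, ← whisker_exchange_assoc]
  simp

end CupCap

/-! ### Partial trace and the splitting it produces -/

section Splitting

variable {k : Type*} [Field k] {C : Type*} [Category* C] [Preadditive C] [Linear k C]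

/-- Placing the relation `e q e = t Q e`, where `e = cap ≫ cup`, between `cup` and `cap` closes one
loop at each end. Both sides acquire the factor `κ²`, which is then cancelled. -/
theorem partial_trace_aux {κ t : k} (hκ : κ ≠ 0) {X Y : C} {cup : X ⟶ Y} {cap : Y ⟶ X}
    {q Q : Y ⟶ Y} {p : X ⟶ X} (hc : cup ≫ cap = κ • 𝟙 X) (hQ : Q ≫ cap = cap ≫ p)
    (h : (cap ≫ cup) ≫ q ≫ cap ≫ cup = t • (Q ≫ cap ≫ cup)) :
    cup ≫ q ≫ cap = t • p := by
  have hc' : ∀ {Z : C} (g : X ⟶ Z), cup ≫ cap ≫ g = κ • g := fun g => by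
    rw [← Category.assoc, hc, Linear.smul_comp, Category.id_comp]
  have h' := congrArg (fun f => cup ≫ f ≫ cap) h
  simp only [Category.assoc, Linear.comp_smul, Linear.smul_comp, reassoc_of% hQ, hc, hc',
    Category.comp_id] at h'
  rw [smul_comm t, smul_comm t] at h'
  exact smul_right_injective (X ⟶ X) hκ (smul_right_injective (X ⟶ X) hκ h')

/-- Here `q` is to be `p_{m+1} ⊗ 1`, `r` is `p_{m+2}`, `p` is `p_m` and `Q` is `p_m ⊗ 1 ⊗ 1`. The
correction term `c • (q ≫ cap ≫ cup ≫ q)` factors through `(X, p)`, and the partial trace `t = c⁻¹`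
makes this factorization a splitting. -/
theorem split_aux {X Y : C} {c t : k} (hct : c * t = 1) {cup : X ⟶ Y} {cap : Y ⟶ X}
    {q Q r : Y ⟶ Y} {p : X ⟶ X} (hp : p ≫ p = p) (hq : q ≫ q = q) (hr : r ≫ r = r)
    (hQ : Q ≫ cap = cap ≫ p) (hqQ : q ≫ Q = q) (htr : cup ≫ q ≫ cap = t • p)
    (hdef : r = q - c • (q ≫ (cap ≫ cup) ≫ q)) :
    IsDirectSum (⟨Y, q, hq⟩ : Idempotents.Karoubi C) ⟨X, p, hp⟩ ⟨Y, r, hr⟩ := by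
  -- `q` absorbs `Q`, which slides through the cap to become `p`; hence `q ≫ cap` already lands in
  -- the image of `p`.
  have hcap : q ≫ cap ≫ p = q ≫ cap := by rw [← hQ, reassoc_of% hqQ]
  have hcap' : ∀ {Z : C} (g : X ⟶ Z), q ≫ cap ≫ p ≫ g = q ≫ cap ≫ g := fun g => by
    simpa only [Category.assoc] using congrArg (· ≫ g) hcap
  -- The scalar `c` is put entirely on the retraction, so that inclusion followed by retraction is
  -- `(c * t) • p = p`.
  refine isDirectSum_karoubi hp hq hr ?_ ?_ (p ≫ cup ≫ q) (c • (q ≫ cap)) ?_ ?_ ?_ ?_ ?_ ?_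
  · rw [hdef]
    simp only [Preadditive.comp_sub, Linear.comp_smul, reassoc_of% hq, hq]
  · rw [hdef]
    simp only [Preadditive.sub_comp, Linear.smul_comp, Category.assoc, hq]
  · rw [reassoc_of% hp]
  · simp only [Category.assoc, hq]
  · simp only [Linear.comp_smul, reassoc_of% hq]
  · simp only [Linear.smul_comp, Category.assoc, hcap]
  · simp only [Linear.comp_smul, Category.assoc, reassoc_of% hq, htr, smul_smul, hct, one_smul, hp]
  · rw [hdef]
    simp only [Linear.smul_comp, Category.assoc, hcap']
    abel

end Splitting

/-! ### Partial trace of the Jones-Wenzl projectors -/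

section Linear

variable {k : Type*} [Field k] {C : Type*} [Category* C] [Preadditive C] [Linear k C]
  [MonoidalCategory C] {A : SelfDualObject C}

/-- The projector and the cap act on disjoint strands, so this is the interchange law; for `m = 0`
both projectors are identities. -/
theorem jonesWenzlRight_cap (η : k) (m : ℕ) :
    A.jonesWenzlRight η m ≫ A.cap m = A.cap m ≫ A.jonesWenzl η m := by
  cases m with
  | zero => exact (Category.id_comp _).trans (Category.comp_id _).symm
  | succ m => exact comm_cap_aux _ A.u

variable [MonoidalPreadditive C] [MonoidalLinear k C]

theorem cup_cap_aux {κ : k} {P T : C} {n : 𝟙_ C ⟶ T ⊗ T} {u : T ⊗ T ⟶ 𝟙_ C}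
    (h : n ≫ u = κ • 𝟙 (𝟙_ C)) :
    ((ρ_ P).inv ≫ P ◁ n ≫ (α_ P T T).inv) ≫ (α_ P T T).hom ≫ P ◁ u ≫ (ρ_ P).hom = κ • 𝟙 P := by
  simp only [Category.assoc, Iso.inv_hom_id_assoc]
  rw [← whiskerLeft_comp_assoc, h]
  simp

theorem cup_cap {κ : k} (hA : A.HasDimension k κ) (m : ℕ) :
    A.cup m ≫ A.cap m = κ • 𝟙 (A.pow m) := by
  cases m with
  | zero => exact hA
  | succ m => exact cup_cap_aux hA

/-- The partial trace of the Jones-Wenzl projector `p_{m+1}`. -/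
theorem cup_jonesWenzl_cap {η : k} (hA : A.HasDimension k (η + η⁻¹)) (hκ : η + η⁻¹ ≠ 0) (m : ℕ)
    (hm : ∀ l, 0 < l → l ≤ m + 1 → quantumNumber η l ≠ 0) :
    A.cup m ≫ (A.jonesWenzl η (m + 1) ▷ A.T : A.pow (m + 2) ⟶ A.pow (m + 2)) ≫ A.cap m =
      (quantumNumber η (m + 2) / quantumNumber η (m + 1)) • A.jonesWenzl η m := by
  refine partial_trace_aux hκ (cup_cap hA m) (jonesWenzlRight_cap η m) ?_
  rw [cap_cup]
  exact (jonesWenzl_aux hA m hm).2.1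

end Linear

end SelfDualObject

/-! ### Fusion with `T_1` in the Temperley-Lieb category -/

namespace TemperleyLieb

variable {k : Type u} [Field k]

open SelfDualObject

/-- The decomposition `T_{m+1} ⊗ T_1 ≅ T_m ⊕ T_{m+2}`. -/
theorem isDirectSum_T_tensor_T_one (κ η : k) (hκ : κ = η + η⁻¹) (hκ0 : κ ≠ 0) (m : ℕ)
    (h : ∀ l, 0 < l → l ≤ m + 2 → quantumNumber η l ≠ 0)
    (h₀ : ∀ l, 0 < l → l ≤ m → quantumNumber η l ≠ 0)
    (h₁ : ∀ l, 0 < l → l ≤ m + 1 → quantumNumber η l ≠ 0)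
    (h₂ : ∀ l, 0 < l → l ≤ 1 → quantumNumber η l ≠ 0) :
    IsDirectSum (T κ η hκ (m + 1) h₁ ⊗ T κ η hκ 1 h₂) (T κ η hκ m h₀) (T κ η hκ (m + 2) h) := by
  subst hκ
  have hA := FreeTL.generator_hasDimension (κ := η + η⁻¹)
  obtain ⟨-, -, h₃⟩ := jonesWenzl_aux hA m h₁
  -- Since `p_1 = 𝟙`, the idempotent of `T_{m+1} ⊗ T_1` is `p_{m+1} ⊗ 𝟙`, which is the whiskered
  -- form occurring in the recursion.
  have hX : (FreeTL.generator (η + η⁻¹)).jonesWenzl η (m + 1) ⊗ₘ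
      𝟙 (FreeTL.generator (η + η⁻¹)).T = _ := tensorHom_id _ _
  have hn1 := h (m + 1) (by omega) (by omega)
  have hn2 := h (m + 2) (by omega) (by omega)
  refine split_aux (t := quantumNumber η (m + 2) / quantumNumber η (m + 1))
    (c := quantumNumber η (m + 1) / quantumNumber η (m + 2)) (by field_simp)
    (cup := (FreeTL.generator (η + η⁻¹)).cup m) _ _ _
    (jonesWenzlRight_cap η m) ?_ ?_ ?_
  · exact (congrArg (· ≫ (FreeTL.generator (η + η⁻¹)).jonesWenzlRight η m) hX).trans
      (h₃.trans hX.symm)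
  · exact (congrArg (fun f => (FreeTL.generator (η + η⁻¹)).cup m ≫ f ≫
      (FreeTL.generator (η + η⁻¹)).cap m) hX).trans (cup_jonesWenzl_cap hA hκ0 m h₁)
  · rw [cap_cup]
    refine Eq.trans ?_ (congrArg (fun f : (FreeTL.generator (η + η⁻¹)).pow (m + 2) ⟶
      (FreeTL.generator (η + η⁻¹)).pow (m + 2) => f -
      (quantumNumber η (m + 1) / quantumNumber η (m + 2)) •
        (f ≫ (FreeTL.generator (η + η⁻¹)).e m ≫ f)) hX).symm
    rfl

end TemperleyLieb

/-! ### The bound `d ≥ 3` -/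

/-- Among orders greater than 2 only 4 would give `d < 3`, and order 4 means `η² = -1`, that is, `η
+ η⁻¹ = 0`. -/
theorem three_le_quantumOrder {k : Type*} [Field k] {η : k} (hκ : η + η⁻¹ ≠ 0)
    (hη : 2 < orderOf η) : 3 ≤ quantumOrder η := by
  have h0 : η ≠ 0 := by
    rintro rfl
    simp at hη
  have h2 : η ^ 2 ≠ 1 := fun h => by
    have := Nat.le_of_dvd two_pos (orderOf_dvd_of_pow_eq_one h)
    omega
  have h4 : orderOf η ≠ 4 := fun h => by
    have h₁ : (η ^ 2 - 1) * (η ^ 2 + 1) = 0 := by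
      linear_combination (h ▸ pow_orderOf_eq_one η : η ^ 4 = 1)
    have h₂ := (mul_eq_zero.mp h₁).resolve_left (sub_ne_zero.mpr h2)
    refine hκ ((mul_eq_zero.mp ?_).resolve_left h0)
    rw [mul_add, mul_inv_cancel₀ h0, ← sq, h₂]
  unfold quantumOrder
  split_ifs with hodd
  · exact hη
  · have := (Nat.not_odd_iff_even.mp hodd).two_dvd
    omega

/-! ### Comparing left and right tensoring with `S_1` -/

section Commutation

variable (k : Type*) [Field k] {D : Type*} [Category* D] [Preadditive D] [HasBinaryBiproducts D]
  [Linear k D] [MonoidalCategory D] [MonoidalPreadditive D]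

theorem finrank_hom_tensor_biprod [∀ X Y : D, Module.Finite k (X ⟶ Y)] (W Z : D) {X Y Y' : D}
    (e : X ≅ Y ⊞ Y') :
    Module.finrank k (W ⟶ Z ⊗ X) =
      Module.finrank k (W ⟶ Z ⊗ Y) + Module.finrank k (W ⟶ Z ⊗ Y') := by
  rw [← finrank_hom_biprod]
  have := preservesBinaryBiproducts_of_preservesBiproducts (tensorLeft Z)
  exact finrank_hom_congr k W ((tensorLeft Z).mapIso e ≪≫ (tensorLeft Z).mapBiprod Y Y')

theorem finrank_hom_biprod_tensor [∀ X Y : D, Module.Finite k (X ⟶ Y)] (W Z : D) {X Y Y' : D}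
    (e : X ≅ Y ⊞ Y') :
    Module.finrank k (W ⟶ X ⊗ Z) =
      Module.finrank k (W ⟶ Y ⊗ Z) + Module.finrank k (W ⟶ Y' ⊗ Z) := by
  rw [← finrank_hom_biprod]
  have := preservesBinaryBiproducts_of_preservesBiproducts (tensorRight Z)
  exact finrank_hom_congr k W ((tensorRight Z).mapIso e ≪≫ (tensorRight Z).mapBiprod Y Y')

/-- If tensoring with `S 1` on either side obeys the same fusion rules, then `S i ⊗ S 1` and
`S 1 ⊗ S i` have the same dimensions of morphism spaces. -/
theorem finrank_hom_tensor_comm [∀ X Y : D, Module.Finite k (X ⟶ Y)] (S : ℕ → D) (N : ℕ)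
    (h₀ : S 0 ≅ 𝟙_ D)
    (hl : ∀ i, i + 2 ≤ N → Nonempty (S 1 ⊗ S (i + 1) ≅ S i ⊞ S (i + 2)))
    (hr : ∀ i, i + 2 ≤ N → Nonempty (S (i + 1) ⊗ S 1 ≅ S i ⊞ S (i + 2))) (W : D) (i : ℕ)
    (hi : i ≤ N) :
    Module.finrank k (W ⟶ S i ⊗ S 1) = Module.finrank k (W ⟶ S 1 ⊗ S i) := by
  induction i using Nat.twoStepInduction with
  | zero =>
    exact finrank_hom_congr k W (whiskerRightIso h₀ (S 1) ≪≫ λ_ (S 1) ≪≫ (ρ_ (S 1)).symm ≪≫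
      whiskerLeftIso (S 1) h₀.symm)
  | one => rfl
  | more i ih _ =>
    -- Morphisms from `W` to `S 1 ⊗ S (i + 1) ⊗ S 1` are counted twice: splitting the left pair
    -- gives `S i ⊗ S 1` and `S (i + 2) ⊗ S 1`, splitting the right pair gives `S 1 ⊗ S i` and `S 1
    -- ⊗ S (i + 2)`. The terms in `S i` cancel by induction.
    obtain ⟨el⟩ := hl i hi
    obtain ⟨er⟩ := hr i hi
    have h₁ := finrank_hom_biprod_tensor k W (S 1) el
    have h₂ := finrank_hom_tensor_biprod k W (S 1) er
    have h₃ := finrank_hom_congr k W (α_ (S 1) (S (i + 1)) (S 1))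
    have h₄ := ih (by omega)
    omega

end Commutation

/-! ### Vanishing of `F(p_{d-1})` and the factorization -/

/-- As an endomorphism of the unsplit object, the idempotent factors through its image `P`, so its
value under `F` factors through the zero object `F.obj P`. -/
theorem map_toKaroubi_p_eq_zero {C D : Type*} [Category* C] [Category* D] [HasZeroMorphisms D]
    (F : Idempotents.Karoubi C ⥤ D) (P : Idempotents.Karoubi C) (h : 𝟙 (F.obj P) = 0) :
    F.map ((Idempotents.toKaroubi C).map P.p) = 0 := by
  rw [Idempotents.Karoubi.decomp_p, F.map_comp, ← Category.id_comp (F.map P.decompId_i), h,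
    zero_comp, comp_zero]

/-- A tensor functor to a category with truncated Temperley-Lieb fusion rules kills the
Jones-Wenzl projector `p_{d-1}`. -/
theorem TemperleyLieb.map_p_eq_zero {k : Type u} [Field k]
    (κ η : k) (hκ : κ = η + η⁻¹) (hκ0 : κ ≠ 0) (hη : 2 < orderOf η)
    {D : Type*} [Category* D] [Abelian D] [Linear k D] [MonoidalCategory D]
    [MonoidalPreadditive D] [∀ X Y : D, Module.Finite k (X ⟶ Y)]
    (S : ℕ → D) (hS : HasTLFusionRules (quantumOrder η) S)
    (F : TemperleyLieb κ ⥤ D) [F.Additive] [F.Monoidal]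
    (hF : ∀ (i : ℕ) (hi : i < quantumOrder η - 1),
      Nonempty (F.obj (T κ η hκ i
        (quantumNumber_ne_zero hη (Nat.lt_of_lt_pred hi))) ≅ S i)) :
    F.map (p κ η (quantumOrder η - 1)) = 0 := by
  -- With `d = m + 3`, the last simple object is `S (m + 1)`, its neighbour is `S m`, and the
  -- projector to be killed is `p_{m+2}`.
  obtain ⟨m, hm⟩ : ∃ m, quantumOrder η = m + 3 :=
    Nat.exists_eq_add_of_le' (three_le_quantumOrder (hκ ▸ hκ0) hη)
  have hq : ∀ n < m + 3, ∀ l, 0 < l → l ≤ n → quantumNumber η l ≠ 0 := fun n hn =>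
    quantumNumber_ne_zero hη (hm ▸ hn)
  simp only [hm] at hS hF
  have hT : ∀ i (hi : i < m + 2), Nonempty (F.obj (T κ η hκ i (hq i (by omega))) ≅ S i) := hF
  -- The summands stay in the form `F(T_i)` because the case `i = m` involves `F(T_{m+2})`, which
  -- corresponds to no `S j` in the hypotheses.
  have hsum : ∀ i (hi : i < m + 1), Nonempty (S (i + 1) ⊗ S 1 ≅
      F.obj (T κ η hκ i (hq i (by omega))) ⊞ F.obj (T κ η hκ (i + 2) (hq _ (by omega)))) := by
    intro i hi
    obtain ⟨e₁⟩ := hT (i + 1) (by omega)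
    obtain ⟨e₂⟩ := hT 1 (by omega)
    obtain ⟨e⟩ := ((isDirectSum_T_tensor_T_one κ η hκ hκ0 i (hq _ (by omega)) (hq _ (by omega))
      (hq _ (by omega)) (hq _ (by omega))).map F).nonempty_iso
    exact ⟨(e₁.symm ⊗ᵢ e₂.symm) ≪≫ Functor.Monoidal.μIso F _ _ ≪≫ e⟩
  obtain ⟨e₀⟩ := hT 0 (by omega)
  have hcomm := fun W => finrank_hom_tensor_comm k S (m + 1)
    -- `T_0` is definitionally the tensor unit, since `p_0 = 𝟙`.
    (e₀.symm ≪≫ (Functor.Monoidal.εIso F).symm)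
    (fun i hi => hS.fusion (i + 1) (by omega) (by omega))
    (fun i hi => by
      obtain ⟨e⟩ := hsum i (by omega)
      obtain ⟨e₁⟩ := hT i (by omega)
      obtain ⟨e₂⟩ := hT (i + 2) (by omega)
      exact ⟨e ≪≫ biprod.mapIso e₁ e₂⟩) W (m + 1) le_rfl
  obtain ⟨e⟩ := hsum m (by omega)
  obtain ⟨e'⟩ := hT m (by omega)
  obtain ⟨eS⟩ : Nonempty (S 1 ⊗ S (m + 1) ≅ S m) := hS.fusion_last
  have hzero : 𝟙 (F.obj (T κ η hκ (m + 2) (hq _ (by omega)))) = 0 := by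
    -- With `W = F(T_{d-1})` as test object, the two counts read `dim Hom(W, F(T_m))` and `dim
    -- Hom(W, F(T_m)) + dim End(W)`; their equality leaves no room for `𝟙 W`.
    let W := F.obj (T κ η hκ (m + 2) (hq _ (by omega)))
    have h₁ := finrank_hom_congr k W e
    have h₂ := finrank_hom_congr k W (eS ≪≫ e'.symm)
    rw [hcomm, finrank_hom_biprod, h₂] at h₁
    have h₃ : Module.finrank k (W ⟶ W) = 0 := by
      change _ = _ + Module.finrank k (W ⟶ W) at h₁
      omega
    have := Module.finrank_zero_iff.mp h₃
    exact Subsingleton.elim _ _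
  have hp : F.map (p κ η (m + 2)) = 0 :=
    map_toKaroubi_p_eq_zero F (T κ η hκ (m + 2) (hq _ (by omega))) hzero
  have hm' : quantumOrder η - 1 = m + 2 := by omega
  rw [hm']
  exact hp

/-- Once `F` is known to kill `p_{d-1}`, the universal property of the tensor quotient supplies the
functor and the monoidal isomorphism. -/
theorem mainTheorem8 {k : Type u} [Field k] [IsAlgClosed k]
    (κ η : k) (hκ : κ = η + η⁻¹) (hκ0 : κ ≠ 0) (hη : 2 < orderOf η)
    {D : Type*} [Category* D] [Abelian D] [Linear k D] [MonoidalCategory D]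
    [MonoidalPreadditive D] [MonoidalLinear k D] [RigidCategory D] [IsFusionCategory k D]
    (S : ℕ → D) (hS : HasTLFusionRules (quantumOrder η) S)
    (F : TemperleyLieb κ ⥤ D) [F.Additive] [F.Linear k] [F.Monoidal]
    (hF : ∀ (i : ℕ) (hi : i < quantumOrder η - 1),
      Nonempty (F.obj (TemperleyLieb.T κ η hκ i
        (quantumNumber_ne_zero hη (Nat.lt_of_lt_pred hi))) ≅ S i)) :
    ∃ (G : TLQuotient κ η ⥤ D) (_ : G.Additive) (_ : G.Linear k) (_ : G.Monoidal)
      (e : TLQuotient.proj κ η ⋙ G ≅ F), NatTrans.IsMonoidal e.hom := by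
  have := IsFusionCategory.finite_hom (k := k) (D := D)
  have h := TemperleyLieb.map_p_eq_zero κ η hκ hκ0 hη S hS F hF
  exact ⟨TensorQuotient.lift F h, inferInstance, inferInstance, inferInstance,
    TensorQuotient.projCompLift F h, inferInstance⟩
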